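/- Let $Sym=\mathbb{Q}[p_1,p_2,\dots]$ be the ring of symmetric functions over $\mathbb{Q}$, with power sums $p_k$, complete and elementary functions $h_n,e_n$, Schur functions $s_\mu$, and the Hall scalar product $\langle p_\mu,p_\nu\rangle=z_\mu\delta_{\mu\nu}$ (extended to the case where the second argument lies in the completion of $Sym$ by degree). The plethysm $f[a]$ is the ring homomorphism in $f$ with $p_k[a]=\psi^k(a)$, where the Adams operation $\psi^k$ sends every power sum $p_j$ to $p_{kj}$ (in each alphabet) and fixes rational constants; in particular $f(X+1)$ is obtained from $f$ by $p_k\mapsto p_k+1$. Put $\sigma_1=\sum_{n\ge0}h_n$, $\lambda_{-1}[a]=\sum_{r\ge0}(-1)^re_r[a]$, and $$\ell_n=\frac1n\sum_{d\mid n}\mu(d)\,p_d^{\,n/d},\qquad \ell=\sum_{n\ge1}\ell_n ,$$ where $\mu(d)$ is the Möbius function; $\ell_n$ is the character of $GL(V)$ on the degree $n$ component of the free Lie algebra on $V$. For a permutation $\tau\in\mathfrak S_n$ let $\Omega_\tau$ be the multiset of eigenvalues of its permutation matrix, and let $\chi^\nu$ be the irreducible character of $\mathfrak S_n$ with Frobenius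 characteristic $s_\nu$. Let $\lambda$ be a partition and $\lambda'$ its conjugate. (1) There is exactly one $\tilde s_\lambda\in Sym$ such that $\tilde s_\lambda(\Omega_\tau)=\chi^{(n-|\lambda|,\lambda)}(\tau)$ for all $n\ge|\lambda|+\lambda_1$ and all $\tau\in\mathfrak S_n$. There is exactly one $\tilde x_\lambda\in Sym$ such that, for all $n\ge 0$ and all $\tau\in\mathfrak S_n$, $\tilde x_\lambda(\Omega_\tau)$ is the value at $\tau$ of the character of $\mathfrak S_n$ whose Frobenius characteristic is the degree $n$ component $h_{n-|\lambda|}s_\lambda$ of $\sigma_1s_\lambda$ (which is $0$ for $n<|\lambda|$). (2) $\tilde s_\lambda$ has a unique expansion $\tilde s_\lambda=\sum_\mu b_\lambda^\mu s_\mu$ as a finite rational linear combination of Schur functions, and for every partition $\mu$ $$b_\lambda^\mu=(-1)^{|\lambda|+|\mu|}\Big\langle s_{\lambda'}(X+1),\ s_{\mu'}\Big[\sum_{n\ge1}\ell_n(X)\Big]\Big\rangle .$$ (3) With the scalar product taken with respect to the alphabet $X$, $$\tilde s_\lambda(Y)=(-1)^{|\lambda|}\big\langle s_{\lambda'}(X),\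 \sigma_1(X)\,\lambda_{-1}[\ell(X)Y]\big\rangle .$$ (4) Likewise $$\tilde x_\lambda(Y)=(-1)^{|\lambda|}\big\langle s_{\lambda'}(X),\ \lambda_{-1}[\ell(X)Y]\big\rangle .$$ -/

import Mathlib

open scoped BigOperators

namespace SymFun

/-! ## Symmetric functions -/

/-- The ring of symmetric functions with rational coefficients, `Sym = ℚ[p₁, p₂, …]`: the variable
`X k` is the power sum `p_k`. -/
abbrev Sym : Type := MvPolynomial ℕ+ ℚ

/-- The completion of `Sym` with respect to the degree (possibly infinite sums of homogeneous
symmetric functions of increasing degrees), with coefficients in `R`. There are only finitely many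
monomials in `p₁, p₂, …` of a given degree, so it is the ring of all power series in
`p₁, p₂, …`. -/
abbrev SymHat (R : Type) : Type := MvPowerSeries ℕ+ R

/-- The power sum `p_n`, `n ≥ 1`. -/
noncomputable def p (n : ℕ) : Sym := MvPolynomial.X n.toPNat'

/-- The exponent vector `(m₁, m₂, …)` of a partition `1^{m₁} 2^{m₂} ⋯`; the monomial with this
exponent vector is the power-sum product `p_μ`. -/
noncomputable def expo {n : ℕ} (μ : n.Partition) : ℕ+ →₀ ℕ :=
  Multiset.toFinsupp (μ.parts.map Nat.toPNat')

/-- `z_μ = ∏ i^{m_i} m_i!`. -/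
def zee (m : ℕ+ →₀ ℕ) : ℚ := m.prod fun i a => ((i : ℕ) : ℚ) ^ a * (a.factorial : ℚ)

/-- The Hall scalar product, for which `⟨p_μ, p_ν⟩ = z_μ δ_{μν}`, of a symmetric function with an
element of the completion (linear in the latter over the coefficient ring). -/
noncomputable def hall {R : Type} [CommRing R] [Algebra ℚ R] (f : Sym) (F : SymHat R) : R :=
  ∑ m ∈ f.support, (f.coeff m * zee m) • MvPowerSeries.coeff m F

/-- The complete symmetric function `h_n = ∑_{μ ⊢ n} p_μ / z_μ`. -/
noncomputable def complete (n : ℕ) : Sym :=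
  ∑ μ : n.Partition, MvPolynomial.monomial (expo μ) (1 / zee (expo μ))

/-- The elementary symmetric function `e_n = ∑_{μ ⊢ n} (-1)^{n - length μ} p_μ / z_μ`. -/
noncomputable def elementary (n : ℕ) : Sym :=
  ∑ μ : n.Partition,
    MvPolynomial.monomial (expo μ) ((-1) ^ (n + μ.parts.card) / zee (expo μ))

/-- `h_k` for an integer `k`, with `h_k = 0` for `k < 0`. -/
noncomputable def completeInt (k : ℤ) : Sym := if k < 0 then 0 else complete k.toNat

/-- The Schur function of a sequence `l₁, …, l_r`, by the Jacobi–Trudi determinant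
`det (h_{l_i - i + j})`. -/
noncomputable def schurSeq (l : List ℕ) : Sym :=
  Matrix.det (Matrix.of fun i j : Fin l.length =>
    completeInt ((l.get i : ℤ) - ((i : ℕ) : ℤ) + ((j : ℕ) : ℤ)))

/-- The Schur function `s_μ` of a partition. -/
noncomputable def schur (μ : YoungDiagram) : Sym := schurSeq μ.rowLens

/-! ## Plethysm -/

/-- The plethysm `f[a]`, where `a` lies in a ring with Adams operations `ψ`: the ring
homomorphism in `f` with `p_k[a] = ψ k a`. -/
noncomputable def pleth {R : Type} [CommRing R] [Algebra ℚ R] (ψ : ℕ+ → R → R)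
    (f : Sym) (a : R) : R :=
  MvPolynomial.aeval (fun k => ψ k a) f

/-- The Adams operations of `Sym`: `ψ^k(p_j) = p_{kj}`, and rational constants are fixed. -/
noncomputable def psi (k : ℕ+) : Sym →ₐ[ℚ] Sym := MvPolynomial.rename fun j => k * j

instance tendstoCofinite_mul (k : ℕ+) : Filter.TendstoCofinite fun j : ℕ+ => k * j :=
  Filter.tendstoCofinite_of_injective (mul_right_injective k)

/-- The Adams operations of the completion, `ψ^k(p_j) = p_{kj}`, acting by `φ` on the
coefficients. -/
noncomputable def psiHat {R : Type} [CommRing R] (φ : R →+* R) (k : ℕ+) (F : SymHat R) :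
    SymHat R :=
  MvPowerSeries.map φ (MvPowerSeries.rename (fun j => k * j) F)

/-- Plethysm into the completion of `Sym`. -/
noncomputable def plethHat (f : Sym) (a : SymHat ℚ) : SymHat ℚ :=
  pleth (psiHat (RingHom.id ℚ)) f a

/-- Plethysm for two alphabets `X`, `Y`: the power series are in the `p_k(X)`, and their
coefficients are symmetric functions of `Y`. -/
noncomputable def plethXY (f : Sym) (a : SymHat Sym) : SymHat Sym :=
  pleth (fun k => psiHat (psi k : Sym →+* Sym) k) f a

/-- The sum of a locally finite family (each monomial occurs in finitely many terms). -/
noncomputable def seriesSum {R : Type} [CommRing R] (F : ℕ → SymHat R) : SymHat R :=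
  fun m => ∑ᶠ n, MvPowerSeries.coeff m (F n)

/-- `σ₁ = ∑_{n ≥ 0} h_n`. -/
noncomputable def sigmaOne : SymHat ℚ :=
  seriesSum fun n => ((complete n : Sym) : SymHat ℚ)

/-- `λ_{-1}[a] = ∑_{r ≥ 0} (-1)^r e_r[a]`, two alphabets. -/
noncomputable def lambdaNegOne (a : SymHat Sym) : SymHat Sym :=
  seriesSum fun r => (-1) ^ r * plethXY (elementary r) a

/-- The character `ℓ_n = (1/n) ∑_{d ∣ n} μ(d) p_d^{n/d}` of `GL(V)` on the homogeneous component
of degree `n ≥ 1` of the free Lie algebra on `V`. -/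
noncomputable def lie (n : ℕ) : Sym :=
  (1 / (n : ℚ)) • ∑ d ∈ n.divisors, ((ArithmeticFunction.moebius d : ℤ) : ℚ) • p d ^ (n / d)

/-- `ℓ = ∑_{n ≥ 1} ℓ_n`. -/
noncomputable def lieSeries : SymHat ℚ :=
  seriesSum fun n => ((lie (n + 1) : Sym) : SymHat ℚ)

/-- A series in the alphabet `X`, seen in two alphabets `X`, `Y`. -/
noncomputable def inX (F : SymHat ℚ) : SymHat Sym :=
  MvPowerSeries.map (MvPolynomial.C : ℚ →+* Sym) F

/-- A symmetric function of `Y`, seen in two alphabets `X`, `Y`. -/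
noncomputable def inY (f : Sym) : SymHat Sym := MvPowerSeries.C f

/-! ## Characters of symmetric groups -/

/-- The value at `τ ∈ S_n` of the class function of `S_n` whose Frobenius characteristic
`∑_{μ ⊢ n} φ(μ) p_μ / z_μ` is the component of degree `n` of `F`. -/
noncomputable def classValue (F : SymHat ℚ) {n : ℕ} (τ : Equiv.Perm (Fin n)) : ℚ :=
  zee (expo τ.partition) * MvPowerSeries.coeff (expo τ.partition) F

/-- `χ^ν(τ)`, where `χ^ν` is the irreducible character of the symmetric group whose Frobenius
characteristic is the Schur function `s_ν` (the partition `ν` is a list of parts). -/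
noncomputable def irrChar (ν : List ℕ) {n : ℕ} (τ : Equiv.Perm (Fin n)) : ℚ :=
  classValue ((schurSeq ν : Sym) : SymHat ℚ) τ

/-- `f(Ω_τ)`, where `Ω_τ` is the multiset of the eigenvalues of the permutation matrix of `τ`. -/
noncomputable def evalEigenvalues (f : Sym) {n : ℕ} (τ : Equiv.Perm (Fin n)) : ℂ :=
  MvPolynomial.aeval
    (fun k : ℕ+ => ((Matrix.charpoly (τ.permMatrix ℂ)).roots.map fun ω => ω ^ (k : ℕ)).sum) f

/-- The defining property of the stable character `s̃_ν`: for every `n` such that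
`(n - |ν|, ν)` is a partition, its value at the eigenvalues of any `τ ∈ S_n` is
`χ^{(n - |ν|, ν)}(τ)`. Here `n = |ν| + m`. -/
def IsStableIrreducible (ν : YoungDiagram) (f : Sym) : Prop :=
  ∀ m : ℕ, ν.rowLen 0 ≤ m → ∀ τ : Equiv.Perm (Fin (ν.card + m)),
    evalEigenvalues f τ = (irrChar (m :: ν.rowLens) τ : ℂ)

/-- The defining property of the stable character `x̃_ν`: for every `n`, its value at the
eigenvalues of any `τ ∈ S_n` is the value at `τ` of the character whose Frobenius characteristic
is the component `h_{n - |ν|} s_ν` of degree `n` of `σ₁ s_ν`. -/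
def IsStableInduced (ν : YoungDiagram) (f : Sym) : Prop :=
  ∀ (n : ℕ) (τ : Equiv.Perm (Fin n)),
    evalEigenvalues f τ = (classValue (sigmaOne * ((schur ν : Sym) : SymHat ℚ)) τ : ℂ)

end SymFun

/-! Let `τ` have `c_N` cycles of length `N`. Then `p_k(Ω_τ) = tr τ^k = ∑_{d ∣ k} d c_d`, and the
theorem rests on one product formula: when `Y` is specialized to `Ω_τ`, the series `λ_{-1}[ℓ(X)Y] =
exp(-∑ p_k(Y) ψ^k(ℓ(X)) / k)` becomes `∏_N (1 - p_N(X))^{c_N}` (`evalLambda_eq`). Both sides satisfy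
the same linear equation for the degree derivation, because the Möbius function in `ℓ` inverts the
divisor sum.

Multiplication by `σ₁` is adjoint to `f ↦ f(X+1)` (`hall_sig_mul`). The product arises from `p_c` by
this shift followed by the antipode `p_k ↦ -p_k`. Hence its pairing with `f` is `z_c` times the
coefficient of `p_c` in `σ₁ · antip f` (`hall_prodOneSub`), which is a value of a class function
with known Frobenius characteristic. For `f = s_{λ'}` the antipode gives `(-1)^{|λ|} s_λ`
(`antip_schur_transpose`), hence the induced character. An extra factor `σ₁` in the pairing replaces
`s_λ` by `s_λ(X-1)`, and the degree `n` component of `σ₁ s_λ(X-1)` is `s_{(n-|λ|,λ)}`, by column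
operations on the Jacobi–Trudi matrix (`coeff_sig_mul_transl_jt`).

So the two explicit series have the required values. Uniqueness holds because cycle counts are
arbitrary natural numbers, so that a symmetric function is determined by its values
(`eq_zero_of_cycleEval`). The Schur coefficients come from pairing with `s_μ(Y)`: Schur functions
are orthonormal (`hall_schur`), and `λ_{-1}[ℓ(X)Y]` is a Cauchy kernel that turns this pairing into
plethysm with `ℓ` (`hall_hall`). Orthonormality and conjugation are themselves obtained from the
Jacobi–Trudi expansions that add or remove a row. -/

namespace SymFun

/-! ## Weights and the pairing `zee` -/

/-- The degree of the power-sum product with exponent vector `e`. -/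
noncomputable def wt : (ℕ+ →₀ ℕ) →+ ℕ := Finsupp.weight fun k : ℕ+ => (k : ℕ)

theorem wt_apply (e : ℕ+ →₀ ℕ) : wt e = e.sum fun k a => a * (k : ℕ) := by
  simp [wt, Finsupp.weight_apply]

@[simp] theorem wt_single (k : ℕ+) (a : ℕ) : wt (Finsupp.single k a) = a * (k : ℕ) := by
  simp [wt, Finsupp.weight_single]

theorem le_wt (e : ℕ+ →₀ ℕ) (k : ℕ+) : e k * (k : ℕ) ≤ wt e := by
  rw [wt_apply]
  by_cases h : k ∈ e.support
  · exact Finset.single_le_sum (f := fun k : ℕ+ => e k * (k : ℕ)) (fun _ _ => Nat.zero_le _) h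
  · simp [Finsupp.notMem_support_iff.1 h]

theorem wt_eq_zero {e : ℕ+ →₀ ℕ} (h : wt e = 0) : e = 0 := by
  ext k
  have := le_wt e k
  have hk := k.pos
  rw [h] at this
  simpa [hk.ne'] using this

theorem finite_wt_le (n : ℕ) : {e : ℕ+ →₀ ℕ | wt e ≤ n}.Finite := by
  -- Entries are at most `n` and indices at most `n`; `n + 1` is used as index bound because it is
  -- positive.
  have : {e : ℕ+ →₀ ℕ | wt e ≤ n} ⊆
      Set.Iic (∑ k ∈ Finset.Icc 1 n.succPNat, Finsupp.single k n) := by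
    intro e he k
    simp only [Set.mem_ofPred_eq] at he
    have h1 := (le_wt e k).trans he
    by_cases hk : k ≤ n.succPNat
    · rw [Finsupp.finsetSum_apply, Finset.sum_eq_single k]
      · simp only [Finsupp.single_eq_same]
        exact (Nat.le_mul_of_pos_right _ k.pos).trans h1
      · intro b _ hb; simp [hb.symm]
      · intro h; simp [hk] at h
    · have h2 : n + 1 < (k : ℕ) := by
        rw [not_le, ← PNat.coe_lt_coe] at hk; simpa using hk
      have : e k = 0 := by
        by_contra h0
        have := Nat.le_mul_of_pos_left (k : ℕ) (Nat.pos_of_ne_zero h0)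
        omega
      rw [this]; exact Nat.zero_le _
  exact (Set.finite_Iic _).subset this

/-- The exponent vectors of degree at most `n`. -/
noncomputable def wtLe (n : ℕ) : Finset (ℕ+ →₀ ℕ) := (finite_wt_le n).toFinset

@[simp] theorem mem_wtLe {n : ℕ} {e : ℕ+ →₀ ℕ} : e ∈ wtLe n ↔ wt e ≤ n := by simp [wtLe]

theorem zee_pos (e : ℕ+ →₀ ℕ) : 0 < zee e := by
  unfold zee
  exact Finset.prod_pos fun k _ => by have := k.pos; positivity

theorem zee_ne_zero (e : ℕ+ →₀ ℕ) : zee e ≠ 0 := (zee_pos e).ne'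

@[simp] theorem zee_zero : zee 0 = 1 := by simp [zee]

theorem zee_add_single (e : ℕ+ →₀ ℕ) (k : ℕ+) :
    zee (e + Finsupp.single k 1) = zee e * ((k : ℕ) * (e k + 1)) := by
  have h (f : ℕ+ →₀ ℕ) : zee f = (f.erase k).prod (fun i a => ((i : ℕ) : ℚ) ^ a * (a.factorial : ℚ))
      * (((k : ℕ) : ℚ) ^ f k * ((f k).factorial : ℚ)) := by
    rw [mul_comm]
    exact (Finsupp.mul_prod_erase' f k _ (by simp)).symm
  have h2 : (e + Finsupp.single k 1).erase k = e.erase k := by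
    ext j
    by_cases hj : j = k
    · simp [hj]
    · simp [Finsupp.erase_ne hj]
  rw [h, h e, h2]
  simp only [Finsupp.add_apply, Finsupp.single_eq_same, Nat.factorial_succ, pow_succ]
  push_cast
  ring

/-! ### Exponent vectors of partitions -/

theorem wt_toFinsupp (s : Multiset ℕ+) :
    wt (Multiset.toFinsupp s) = (s.map fun k : ℕ+ => (k : ℕ)).sum := by
  induction s using Multiset.induction_on with
  | empty => simp
  | cons a s ih =>
    rw [← Multiset.singleton_add, map_add, map_add, ih, Multiset.toFinsupp_singleton, wt_single]
    simp

theorem degree_toFinsupp (s : Multiset ℕ+) : (Multiset.toFinsupp s).degree = s.card := by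
  induction s using Multiset.induction_on with
  | empty => simp
  | cons a s ih =>
    rw [← Multiset.singleton_add, map_add, map_add, ih, Multiset.toFinsupp_singleton,
      Finsupp.degree_single, Multiset.card_add, Multiset.card_singleton]

theorem wt_expo {n : ℕ} (μ : n.Partition) : wt (expo μ) = n := by
  rw [expo, wt_toFinsupp, Multiset.map_map]
  conv_rhs => rw [← μ.parts_sum]
  congr 1
  refine (Multiset.map_congr rfl fun i hi => ?_).trans (Multiset.map_id' _)
  simp [μ.parts_pos hi]

theorem degree_expo {n : ℕ} (μ : n.Partition) : (expo μ).degree = μ.parts.card := by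
  rw [expo, degree_toFinsupp, Multiset.card_map]

theorem expo_apply {n : ℕ} (μ : n.Partition) (k : ℕ+) : expo μ k = μ.parts.count (k : ℕ) := by
  rw [expo, Multiset.toFinsupp_apply]
  have h : ∀ s : Multiset ℕ, (∀ i ∈ s, 0 < i) → (s.map Nat.toPNat').count k = s.count (k : ℕ) := by
    intro s
    induction s using Multiset.induction_on with
    | empty => simp
    | cons a s ih =>
      intro hs
      rw [Multiset.map_cons, Multiset.count_cons, Multiset.count_cons,
        ih fun i hi => hs i (Multiset.mem_cons_of_mem hi)]
      congr 1
      have ha := hs a (Multiset.mem_cons_self a s)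
      have : k = a.toPNat' ↔ (k : ℕ) = a := by
        rw [← PNat.coe_inj, Nat.toPNat'_coe, if_pos ha]
      simp [this]
  exact h _ fun i hi => μ.parts_pos hi

theorem expo_injective {n : ℕ} : Function.Injective (expo : n.Partition → ℕ+ →₀ ℕ) := by
  intro μ ν h
  ext i
  rcases Nat.eq_zero_or_pos i with rfl | hi
  · rw [Multiset.count_eq_zero_of_notMem fun h => absurd (μ.parts_pos h) (lt_irrefl _),
      Multiset.count_eq_zero_of_notMem fun h => absurd (ν.parts_pos h) (lt_irrefl _)]
  · obtain ⟨k, rfl⟩ : ∃ k : ℕ+, (k : ℕ) = i := ⟨⟨i, hi⟩, rfl⟩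
    rw [← expo_apply, h, expo_apply]

theorem exists_expo {n : ℕ} (e : ℕ+ →₀ ℕ) (h : wt e = n) : ∃ μ : n.Partition, expo μ = e := by
  let s : Multiset ℕ := (Finsupp.toMultiset e).map fun k : ℕ+ => (k : ℕ)
  refine ⟨⟨s, ?_, ?_⟩, ?_⟩
  · intro i hi
    obtain ⟨k, -, rfl⟩ := Multiset.mem_map.1 hi
    exact k.pos
  · rw [← wt_toFinsupp, Finsupp.toMultiset_toFinsupp, h]
  · simp only [expo, s, Multiset.map_map]
    have : (Nat.toPNat' ∘ fun k : ℕ+ => (k : ℕ)) = id := by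
      funext k; simp
    rw [this, Multiset.map_id, Finsupp.toMultiset_toFinsupp]

theorem coeff_sum_expo {n : ℕ} (g : n.Partition → ℚ) (g' : (ℕ+ →₀ ℕ) → ℚ)
    (hg : ∀ μ, g μ = g' (expo μ)) (e : ℕ+ →₀ ℕ) :
    MvPolynomial.coeff e (∑ μ : n.Partition, MvPolynomial.monomial (expo μ) (g μ)) =
      if wt e = n then g' e else 0 := by
  classical
  simp only [MvPolynomial.coeff_sum, MvPolynomial.coeff_monomial]
  split_ifs with h
  · obtain ⟨μ, rfl⟩ := exists_expo e h
    rw [Finset.sum_eq_single μ]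
    · simp [hg]
    · intro ν _ hν
      rw [if_neg fun h => hν (expo_injective h)]
    · simp
  · refine Finset.sum_eq_zero fun μ _ => if_neg ?_
    rintro rfl
    exact h (wt_expo μ)

theorem coeff_complete (n : ℕ) (e : ℕ+ →₀ ℕ) :
    (complete n).coeff e = if wt e = n then 1 / zee e else 0 :=
  coeff_sum_expo _ (fun e => 1 / zee e) (fun _ => rfl) e

theorem coeff_elementary (n : ℕ) (e : ℕ+ →₀ ℕ) :
    (elementary n).coeff e = if wt e = n then (-1) ^ (n + e.degree) / zee e else 0 :=
  coeff_sum_expo _ (fun e => (-1) ^ (n + e.degree) / zee e) (fun μ => by simp [degree_expo]) e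

/-- The series `exp (c ∑ p_k / k)`. -/
noncomputable def sig (c : ℚ) : SymHat ℚ := fun e => c ^ e.degree / zee e

theorem coeff_sig (c : ℚ) (e : ℕ+ →₀ ℕ) : MvPowerSeries.coeff e (sig c) = c ^ e.degree / zee e :=
  rfl

theorem sigmaOne_eq : sigmaOne = sig 1 := by
  ext e
  change (∑ᶠ n, MvPowerSeries.coeff e ((complete n : Sym) : SymHat ℚ)) = _
  rw [finsum_eq_single _ (wt e)]
  · simp [coeff_complete, coeff_sig]
  · intro n hn
    simp [coeff_complete, hn.symm]

/-! ## The Hall scalar product -/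

section Hall
variable {R : Type} [CommRing R] [Algebra ℚ R]

theorem hall_eq_sum_of_subset {f : Sym} {s : Finset (ℕ+ →₀ ℕ)} (h : f.support ⊆ s) (F : SymHat R) :
    hall f F = ∑ e ∈ s, (f.coeff e * zee e) • MvPowerSeries.coeff e F := by
  refine Finset.sum_subset h fun e _ he => ?_
  rw [MvPolynomial.notMem_support_iff.1 he, zero_mul, zero_smul]

theorem hall_add_left (f g : Sym) (F : SymHat R) : hall (f + g) F = hall f F + hall g F := by
  classical
  rw [hall_eq_sum_of_subset (s := f.support ∪ g.support) MvPolynomial.support_add,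
    hall_eq_sum_of_subset (s := f.support ∪ g.support) Finset.subset_union_left,
    hall_eq_sum_of_subset (s := f.support ∪ g.support) Finset.subset_union_right,
    ← Finset.sum_add_distrib]
  exact Finset.sum_congr rfl fun e _ => by rw [MvPolynomial.coeff_add, add_mul, add_smul]

theorem hall_smul_left (c : ℚ) (f : Sym) (F : SymHat R) : hall (c • f) F = c • hall f F := by
  rw [hall_eq_sum_of_subset (s := f.support) MvPolynomial.support_smul, hall, Finset.smul_sum]
  exact Finset.sum_congr rfl fun e _ => by
    rw [MvPolynomial.coeff_smul, smul_eq_mul, mul_assoc, mul_smul]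

theorem hall_add_right (f : Sym) (F G : SymHat R) : hall f (F + G) = hall f F + hall f G := by
  simp [hall, smul_add, Finset.sum_add_distrib]

theorem hall_monomial (e : ℕ+ →₀ ℕ) (c : ℚ) (F : SymHat R) :
    hall (MvPolynomial.monomial e c) F = (c * zee e) • MvPowerSeries.coeff e F := by
  classical
  rw [hall_eq_sum_of_subset MvPolynomial.support_monomial_subset]
  simp

/-- The Hall scalar product, as a linear map in both arguments. -/
noncomputable def hallₗ : Sym →ₗ[ℚ] SymHat R →ₗ[ℚ] R :=
  LinearMap.mk₂ ℚ hall hall_add_left hall_smul_left hall_add_right fun c f F => by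
    simp only [hall, Finset.smul_sum]
    refine Finset.sum_congr rfl fun e _ => ?_
    rw [smul_comm]
    rfl

@[simp] theorem hallₗ_apply (f : Sym) (F : SymHat R) : hallₗ f F = hall f F := rfl

theorem hall_smul_right (c : ℚ) (f : Sym) (F : SymHat R) : hall f (c • F) = c • hall f F :=
  (hallₗ f).map_smul c F

theorem hall_congr {f : Sym} {F G : SymHat R}
    (h : ∀ e, f.coeff e ≠ 0 → MvPowerSeries.coeff e F = MvPowerSeries.coeff e G) :
    hall f F = hall f G :=
  Finset.sum_congr rfl fun e he => by rw [h e (MvPolynomial.mem_support_iff.1 he)]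

/-- With `φ` acting on functions of `Y`, this lets a specialization of `Y` or a pairing in `Y` pass
through the pairing in `X`. -/
theorem hall_map {R' : Type} [CommRing R'] [Algebra ℚ R'] (φ : R →ₗ[ℚ] R') (f : Sym)
    (F : SymHat R) : φ (hall f F) = hall f (fun e => φ (F e) : SymHat R') := by
  simp only [hall, map_sum, map_smul]
  rfl

end Hall

/-- Adding one to `m_k` multiplies `z_m` by `k (m_k + 1)`, and `m_k + 1` is the factor produced by
the derivative. -/
theorem hall_X_mul (k : ℕ+) (f : Sym) (F : SymHat ℚ) :
    hall (MvPolynomial.X k * f) F = (k : ℕ) * hall f (MvPowerSeries.pderiv ℚ k F) := by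
  induction f using MvPolynomial.induction_on' with
  | monomial e a =>
    rw [mul_comm, MvPolynomial.X, MvPolynomial.monomial_mul, hall_monomial, hall_monomial,
      zee_add_single, MvPowerSeries.coeff_pderiv]
    simp only [smul_eq_mul]
    ring
  | add f g hf hg => rw [mul_add, hall_add_left, hf, hg, hall_add_left, mul_add]

theorem pderiv_sig (k : ℕ+) (c : ℚ) :
    MvPowerSeries.pderiv ℚ k (sig c) = (c / (k : ℕ)) • sig c := by
  ext e
  rw [MvPowerSeries.coeff_pderiv, MvPowerSeries.coeff_smul, coeff_sig, coeff_sig,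
    zee_add_single, map_add, Finsupp.degree_single, pow_succ]
  have h1 := zee_ne_zero e
  have h2 : ((k : ℕ) : ℚ) ≠ 0 := by exact_mod_cast k.ne_zero
  have h3 : (e k : ℚ) + 1 ≠ 0 := by positivity
  field_simp

/-! ### Translations and the antipode -/

/-- The substitution `p_k ↦ p_k + c`. -/
noncomputable def transl (c : ℚ) : Sym →ₐ[ℚ] Sym :=
  MvPolynomial.aeval fun k => MvPolynomial.X k + MvPolynomial.C c

@[simp] theorem transl_X (c : ℚ) (k : ℕ+) :
    transl c (MvPolynomial.X k) = MvPolynomial.X k + MvPolynomial.C c := by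
  simp [transl]

/-- Multiplication by `exp (c ∑ p_k / k)` is adjoint to the substitution `p_k ↦ p_k + c`. -/
theorem hall_sig_mul (c : ℚ) (f : Sym) (F : SymHat ℚ) :
    hall f (sig c * F) = hall (transl c f) F := by
  induction f using MvPolynomial.induction_on generalizing F with
  | C a =>
    rw [← MvPolynomial.algebraMap_eq, AlgHom.commutes, MvPolynomial.algebraMap_eq, MvPolynomial.C_apply,
      hall_monomial,
      hall_monomial]
    have : MvPowerSeries.constantCoeff (sig c) = 1 := by
      rw [← MvPowerSeries.coeff_zero_eq_constantCoeff_apply, coeff_sig]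
      simp
    simp [this]
  | add f g hf hg => rw [hall_add_left, hf, hg, map_add, hall_add_left]
  -- Moved across, `p_k` acts as `k ∂/∂p_k`. On the exponential series this is multiplication by
  -- `c`, which accounts for the constant in `p_k + c`.
  | mul_X f k hf =>
    have h2 : ((k : ℕ) : ℚ) ≠ 0 := by exact_mod_cast k.ne_zero
    rw [mul_comm, hall_X_mul, Derivation.leibniz, hall_add_right, pderiv_sig, map_mul, transl_X,
      add_mul, hall_add_left, hall_X_mul, ← MvPolynomial.smul_eq_C_mul, hall_smul_left,
      smul_eq_mul, hf, smul_eq_mul, mul_smul_comm, hall_smul_right, mul_comm F, hf, smul_eq_mul,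
      smul_eq_mul]
    field_simp

theorem hall_comm (f g : Sym) : hall f (g : SymHat ℚ) = hall g (f : SymHat ℚ) := by
  classical
  rw [hall_eq_sum_of_subset (s := f.support ∪ g.support) Finset.subset_union_left,
    hall_eq_sum_of_subset (s := f.support ∪ g.support) Finset.subset_union_right]
  refine Finset.sum_congr rfl fun e _ => ?_
  simp only [MvPolynomial.coeff_coe, smul_eq_mul]
  ring

/-- Power-sum products are orthogonal with squared norms `z_μ > 0`, so the form is positive definite
over `ℚ`. -/
theorem hall_self_eq_zero {f : Sym} (h : hall f (f : SymHat ℚ) = 0) : f = 0 := by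
  ext e
  simp only [hall, MvPolynomial.coeff_coe, smul_eq_mul] at h
  rw [Finset.sum_eq_zero_iff_of_nonneg fun e _ => by
    rw [mul_right_comm]; exact mul_nonneg (mul_self_nonneg _) (zee_pos e).le] at h
  by_contra h0
  have := h e (MvPolynomial.mem_support_iff.2 h0)
  have h1 := zee_ne_zero e
  simp_all

/-- The antipode `p_k ↦ -p_k`. -/
noncomputable def antip : Sym →ₐ[ℚ] Sym := MvPolynomial.aeval fun k => -MvPolynomial.X k

@[simp] theorem antip_X (k : ℕ+) : antip (MvPolynomial.X k) = -MvPolynomial.X k := by simp [antip]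

theorem antip_monomial (d : ℕ+ →₀ ℕ) (a : ℚ) :
    antip (MvPolynomial.monomial d a) = MvPolynomial.monomial d ((-1) ^ d.degree * a) := by
  rw [antip, MvPolynomial.aeval_monomial, MvPolynomial.monomial_eq, MvPolynomial.C_mul]
  simp only [Finsupp.prod, neg_pow (MvPolynomial.X (R := ℚ) _), MvPolynomial.algebraMap_eq,
    Finset.prod_mul_distrib, Finset.prod_pow_eq_pow_sum, Finsupp.degree_apply, map_pow, map_neg,
    map_one]
  ring

theorem coeff_antip (f : Sym) (e : ℕ+ →₀ ℕ) :
    (antip f).coeff e = (-1) ^ e.degree * f.coeff e := by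
  classical
  induction f using MvPolynomial.induction_on' with
  | monomial d a =>
    rw [antip_monomial, MvPolynomial.coeff_monomial, MvPolynomial.coeff_monomial]
    split_ifs with h
    · rw [h]
    · simp
  | add f g hf hg => rw [map_add, MvPolynomial.coeff_add, hf, hg, MvPolynomial.coeff_add, mul_add]

theorem antip_antip (f : Sym) : antip (antip f) = f := by
  ext e
  rw [coeff_antip, coeff_antip, ← mul_assoc, ← mul_pow]
  simp

theorem hall_antip (f : Sym) (F : SymHat ℚ) :
    hall (antip f) F = hall f (fun e => (-1) ^ e.degree * F e : SymHat ℚ) := by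
  have hs : (antip f).support ⊆ f.support := fun e he => by
    rw [MvPolynomial.mem_support_iff, coeff_antip] at he
    exact MvPolynomial.mem_support_iff.2 (right_ne_zero_of_mul he)
  rw [hall_eq_sum_of_subset hs]
  refine Finset.sum_congr rfl fun e _ => ?_
  change _ = _ • ((-1) ^ e.degree * MvPowerSeries.coeff e F)
  rw [coeff_antip, smul_eq_mul, smul_eq_mul]
  ring

theorem hall_antip_antip (f g : Sym) :
    hall (antip f) ((antip g : Sym) : SymHat ℚ) = hall f (g : SymHat ℚ) := by
  rw [hall_antip]
  refine hall_congr fun e _ => ?_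
  change (-1) ^ e.degree * MvPowerSeries.coeff e ((antip g : Sym) : SymHat ℚ) = _
  rw [MvPolynomial.coeff_coe, MvPolynomial.coeff_coe, coeff_antip, ← mul_assoc, ← mul_pow]
  simp

theorem transl_antip (c : ℚ) (f : Sym) : transl c (antip f) = antip (transl (-c) f) := by
  change (transl c).comp antip f = (antip.comp (transl (-c))) f
  congr 1
  ext k : 1
  simp [antip, transl, add_comm, MvPolynomial.algebraMap_eq]

theorem transl_transl_neg (c : ℚ) (f : Sym) : transl c (transl (-c) f) = f := by
  change (transl c).comp (transl (-c)) f = AlgHom.id ℚ _ f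
  congr 1
  ext k : 1
  simp [transl]

/-! ## Homogeneous series -/

/-- The series `F` is homogeneous of degree `d`. -/
def HasDeg (F : SymHat ℚ) (d : ℤ) : Prop := ∀ e, MvPowerSeries.coeff e F ≠ 0 → (wt e : ℤ) = d

theorem hasDeg_zero (d : ℤ) : HasDeg 0 d := fun e h => absurd (by simp) h

theorem hasDeg_one : HasDeg 1 0 := fun e h => by
  classical
  rw [MvPowerSeries.coeff_one] at h
  have : e = 0 := by by_contra h0; simp [h0] at h
  simp [this]

theorem HasDeg.add {F G : SymHat ℚ} {d : ℤ} (hF : HasDeg F d) (hG : HasDeg G d) :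
    HasDeg (F + G) d := fun e h => by
  by_contra h0
  exact h (by rw [map_add, not_not.1 (mt (hF e) h0), not_not.1 (mt (hG e) h0), add_zero])

theorem HasDeg.mul {F G : SymHat ℚ} {d d' : ℤ} (hF : HasDeg F d) (hG : HasDeg G d') :
    HasDeg (F * G) (d + d') := fun e h => by
  classical
  rw [MvPowerSeries.coeff_mul] at h
  obtain ⟨x, hx, h1⟩ := Finset.exists_ne_zero_of_sum_ne_zero h
  rw [← hF _ (left_ne_zero_of_mul h1), ← hG _ (right_ne_zero_of_mul h1),
    ← Finset.HasAntidiagonal.mem_antidiagonal.1 hx, map_add, Nat.cast_add]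

theorem hasDeg_intCast (z : ℤ) : HasDeg (z : SymHat ℚ) 0 := fun e h => by
  classical
  rw [← map_intCast (MvPowerSeries.C (σ := ℕ+) (R := ℚ)), MvPowerSeries.coeff_C] at h
  have : e = 0 := by by_contra h0; simp [h0] at h
  simp [this]

theorem HasDeg.sum {ι : Type*} {s : Finset ι} {F : ι → SymHat ℚ} {d : ℤ}
    (h : ∀ i ∈ s, HasDeg (F i) d) : HasDeg (∑ i ∈ s, F i) d := by
  classical
  induction s using Finset.induction_on with
  | empty => simpa using hasDeg_zero d
  | insert a s ha ih =>
    rw [Finset.sum_insert ha]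
    exact (h _ (Finset.mem_insert_self _ _)).add (ih fun i hi => h i (Finset.mem_insert_of_mem hi))

theorem HasDeg.prod {ι : Type*} {s : Finset ι} {F : ι → SymHat ℚ} {d : ι → ℤ}
    (h : ∀ i ∈ s, HasDeg (F i) (d i)) : HasDeg (∏ i ∈ s, F i) (∑ i ∈ s, d i) := by
  classical
  induction s using Finset.induction_on with
  | empty => simpa using hasDeg_one
  | insert a s ha ih =>
    rw [Finset.prod_insert ha, Finset.sum_insert ha]
    exact (h _ (Finset.mem_insert_self _ _)).mul (ih fun i hi => h i (Finset.mem_insert_of_mem hi))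

/-- Each term of the determinant uses every row and every column once, so all terms have the same
degree. -/
theorem hasDeg_det {n : ℕ} {M : Matrix (Fin n) (Fin n) (SymHat ℚ)} {r c : Fin n → ℤ}
    (h : ∀ i j, HasDeg (M i j) (r i + c j)) : HasDeg M.det (∑ i, r i + ∑ j, c j) := by
  rw [Matrix.det_apply']
  refine HasDeg.sum fun σ _ => ?_
  have h1 : HasDeg (∏ i, M (σ i) i) (∑ i, (r (σ i) + c i)) := HasDeg.prod fun i _ => h _ _
  rw [Finset.sum_add_distrib, Equiv.sum_comp σ r] at h1
  simpa using (hasDeg_intCast _).mul h1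

/-- Allows an inhomogeneous series, such as `σ₁`, to be replaced by one of its components when it
multiplies a homogeneous minor. -/
theorem HasDeg.coeff_mul_congr {Q : SymHat ℚ} {q : ℤ} (hQ : HasDeg Q q) {P P' : SymHat ℚ}
    {e : ℕ+ →₀ ℕ}
    (h : ∀ a, (wt a : ℤ) + q = wt e → MvPowerSeries.coeff a P = MvPowerSeries.coeff a P') :
    MvPowerSeries.coeff e (P * Q) = MvPowerSeries.coeff e (P' * Q) := by
  classical
  rw [MvPowerSeries.coeff_mul, MvPowerSeries.coeff_mul]
  refine Finset.sum_congr rfl fun x hx => ?_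
  by_cases hx2 : MvPowerSeries.coeff x.2 Q = 0
  · rw [hx2, mul_zero, mul_zero]
  · rw [h x.1]
    rw [← hQ _ hx2, ← Finset.HasAntidiagonal.mem_antidiagonal.1 hx, map_add, Nat.cast_add]

theorem coeff_neg_one_pow_mul (j : ℕ) (F : SymHat ℚ) (e : ℕ+ →₀ ℕ) :
    MvPowerSeries.coeff e ((-1) ^ j * F) = (-1) ^ j * MvPowerSeries.coeff e F := by
  rcases neg_one_pow_eq_or (SymHat ℚ) j with h | h <;> rcases neg_one_pow_eq_or ℚ j with h' | h' <;>
    rcases Nat.even_or_odd j with hj | hj <;> simp [hj.neg_one_pow]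

/-! ## Complete symmetric functions of integer degree -/

theorem complete_zero : complete 0 = 1 := by
  classical
  ext e
  rw [coeff_complete, MvPolynomial.coeff_one]
  by_cases h : e = 0
  · subst h; simp
  · rw [if_neg fun h1 => h (wt_eq_zero h1), if_neg (Ne.symm h)]

/-- Newton's identity. -/
theorem newton (n : ℕ) : ((n : ℚ) + 1) • complete (n + 1) =
    ∑ i ∈ Finset.range (n + 1), MvPolynomial.X i.succPNat * complete (n - i) := by
  classical
  ext e
  simp only [MvPolynomial.coeff_smul, MvPolynomial.coeff_sum, MvPolynomial.coeff_X_mul',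
    coeff_complete]
  -- Removing one part `k = i + 1` divides `z_e` by `k e_k`. The contributions therefore add up to
  -- `∑ k e_k / z_e`, and `∑ k e_k` is the degree `n + 1`.
  have key : ∀ i : ℕ, i ∈ Finset.range (n + 1) →
      (if i.succPNat ∈ e.support then
        if wt (e - Finsupp.single i.succPNat 1) = n - i then
          1 / zee (e - Finsupp.single i.succPNat 1) else 0 else 0) =
      (if wt e = n + 1 then 1 / zee e else 0) * (e i.succPNat * (i + 1 : ℕ)) := by
    intro i hi
    rw [Finset.mem_range] at hi
    by_cases h1 : e i.succPNat = 0
    · rw [if_neg (by simpa using h1), h1]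
      simp
    · obtain ⟨d, rfl⟩ : ∃ d, e = d + Finsupp.single i.succPNat 1 :=
        ⟨e - Finsupp.single i.succPNat 1, (tsub_add_cancel_of_le (by
          rw [Finsupp.single_le_iff]; exact Nat.one_le_iff_ne_zero.2 h1)).symm⟩
      have h2 : wt (d + Finsupp.single i.succPNat 1) = wt d + (i + 1) := by
        rw [map_add, wt_single, Nat.succPNat_coe, one_mul]
      rw [if_pos (Finsupp.mem_support_iff.2 h1), add_tsub_cancel_right, h2]
      by_cases h3 : wt d = n - i
      · rw [if_pos h3, if_pos (by omega), zee_add_single]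
        have h4 := zee_ne_zero d
        have h5 : (d i.succPNat : ℚ) + 1 ≠ 0 := by positivity
        have h6 : (i : ℚ) + 1 ≠ 0 := by positivity
        simp
        field_simp
      · rw [if_neg h3, if_neg (by omega), zero_mul]
  rw [Finset.sum_congr rfl key, ← Finset.mul_sum]
  split_ifs with h
  · have : (∑ i ∈ Finset.range (n + 1), (e i.succPNat : ℚ) * ((i + 1 : ℕ) : ℚ)) = (n : ℚ) + 1 := by
      have h2 : ∑ i ∈ Finset.range (n + 1), e i.succPNat * (i + 1) = n + 1 := by
        conv_rhs => rw [← h, wt_apply]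
        rw [Finsupp.sum_of_support_subset
          (s := (Finset.range (n + 1)).map ⟨Nat.succPNat, Nat.succPNat_injective⟩)]
        · simp [Finset.sum_map]
        · intro k hk
          have := le_wt e k
          have h3 := Nat.le_mul_of_pos_left (k : ℕ) (Nat.pos_of_ne_zero (Finsupp.mem_support_iff.1 hk))
          simp only [Finset.mem_map, Finset.mem_range, Function.Embedding.coeFn_mk]
          exact ⟨k.natPred, by have := k.natPred_add_one; omega, PNat.succPNat_natPred k⟩
        · simp
      exact_mod_cast h2
    rw [this, smul_eq_mul, mul_comm]
  · simp

theorem completeInt_natCast (n : ℕ) : completeInt n = complete n := by simp [completeInt]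

theorem completeInt_of_neg {k : ℤ} (h : k < 0) : completeInt k = 0 := by simp [completeInt, h]

theorem coeff_completeInt (k : ℤ) (e : ℕ+ →₀ ℕ) :
    (completeInt k).coeff e = if (wt e : ℤ) = k then 1 / zee e else 0 := by
  rcases lt_or_ge k 0 with h | h
  · rw [completeInt_of_neg h, if_neg (by omega), MvPolynomial.coeff_zero]
  · lift k to ℕ using h
    simp [completeInt_natCast, coeff_complete]

theorem hasDeg_completeInt (k : ℤ) : HasDeg (completeInt k : Sym) k := fun e h => by
  rw [MvPolynomial.coeff_coe, coeff_completeInt] at h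
  by_contra h0
  simp [h0] at h

/-- In generating functions, `σ_t(X-1) = (1-t) σ_t(X)`; here it is derived by induction from
Newton's identity. -/
theorem transl_complete_succ (n : ℕ) :
    transl (-1) (complete (n + 1)) = complete (n + 1) - complete n := by
  induction n using Nat.strong_induction_on with
  | _ n ih =>
    -- `g j` is `h_{j-1}` with `g 0 = 0`, so the induction hypothesis has one form that includes `j
    -- = 0`.
    let g : ℕ → Sym := fun j => completeInt ((j : ℤ) - 1)
    have g0 : g 0 = 0 := completeInt_of_neg (by simp)
    have gs (j : ℕ) : g (j + 1) = complete j := by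
      rw [← completeInt_natCast]; simp [g]
    have ih' : ∀ j ≤ n, transl (-1) (complete j) = complete j - g j := by
      rintro (_ | j) hj
      · simp [g0, complete_zero]
      · rw [ih j hj, gs]
    have h1 : ((n : ℚ) + 1) • transl (-1) (complete (n + 1)) =
        ∑ i ∈ Finset.range (n + 1), (MvPolynomial.X i.succPNat - 1) *
          (complete (n - i) - g (n - i)) := by
      rw [← map_smul, newton, map_sum]
      refine Finset.sum_congr rfl fun i _ => ?_
      rw [map_mul, transl_X, ih' _ (Nat.sub_le _ _), map_neg, map_one, ← sub_eq_add_neg]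
    have h2 : ∑ i ∈ Finset.range (n + 1), (complete (n - i) - g (n - i)) = complete n := by
      have := Finset.sum_range_reflect (fun j => complete j - g j) (n + 1)
      simp only [Nat.add_sub_cancel] at this
      rw [this, Finset.sum_congr rfl fun j _ => by rw [← gs], Finset.sum_range_sub, g0, gs, sub_zero]
    -- Newton's identity one degree lower; the last summand vanishes because `g 0 = 0`.
    have h3 : ∑ i ∈ Finset.range (n + 1), MvPolynomial.X i.succPNat * g (n - i) =
        (n : ℚ) • complete n := by
      rw [Finset.sum_range_succ, Nat.sub_self, g0, mul_zero, add_zero]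
      cases n with
      | zero => simp
      | succ n =>
        push_cast
        rw [newton]
        refine Finset.sum_congr rfl fun i hi => ?_
        rw [Finset.mem_range] at hi
        rw [show n + 1 - i = (n - i) + 1 by omega, gs]
    have hn : (n : ℚ) + 1 ≠ 0 := by positivity
    apply smul_right_injective Sym hn
    simp only
    rw [h1]
    rw [Finset.sum_congr rfl fun i _ => (sub_one_mul _ _).trans (by rw [mul_sub]),
      Finset.sum_sub_distrib, Finset.sum_sub_distrib, h2, h3, ← newton, smul_sub,
      add_smul _ _ (complete n), one_smul]
    abel

theorem transl_neg_one_completeInt (k : ℤ) :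
    transl (-1) (completeInt k) = completeInt k - completeInt (k - 1) := by
  rcases lt_or_ge k 0 with h | h
  · rw [completeInt_of_neg h, completeInt_of_neg (by omega), map_zero, sub_zero]
  · lift k to ℕ using h
    cases k with
    | zero =>
      rw [completeInt_natCast, completeInt_of_neg (by simp), complete_zero, map_one, sub_zero]
    | succ n =>
      rw [completeInt_natCast, transl_complete_succ, ← completeInt_natCast n]
      simp

theorem transl_one_completeInt (k : ℤ) :
    transl 1 (completeInt k) = completeInt k + transl 1 (completeInt (k - 1)) := by
  have := congrArg (transl 1) (transl_neg_one_completeInt k)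
  rw [transl_transl_neg, map_sub] at this
  exact sub_eq_iff_eq_add.1 this.symm

/-! ## Jacobi–Trudi determinants -/

/-- The determinant `det (h_{a_i - i + j})` for a sequence of integers. -/
noncomputable def jt {n : ℕ} (a : Fin n → ℤ) : Sym :=
  Matrix.det (Matrix.of fun i j : Fin n => completeInt (a i - ((i : ℕ) : ℤ) + ((j : ℕ) : ℤ)))

theorem schurSeq_eq_jt (l : List ℕ) : schurSeq l = jt fun i => (l.get i : ℤ) := rfl

theorem schurSeq_cons (m : ℕ) (l : List ℕ) :
    schurSeq (m :: l) = jt (Fin.cons (m : ℤ) fun i => (l.get i : ℤ) : Fin (l.length + 1) → ℤ) := by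
  rw [schurSeq_eq_jt]
  congr 1
  funext i
  refine Fin.cases ?_ (fun i => ?_) i <;> rfl

theorem coe_sub (f g : Sym) : ((f - g : Sym) : SymHat ℚ) = (f : SymHat ℚ) - (g : SymHat ℚ) :=
  map_sub MvPolynomial.coeToMvPowerSeries.ringHom f g

theorem coe_det {n : ℕ} (M : Matrix (Fin n) (Fin n) Sym) :
    ((M.det : Sym) : SymHat ℚ) = (M.map fun f => (f : SymHat ℚ)).det :=
  RingHom.map_det MvPolynomial.coeToMvPowerSeries.ringHom M

theorem hasDeg_jt {n : ℕ} (a : Fin n → ℤ) : HasDeg (jt a : Sym) (∑ i, a i) := by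
  rw [jt, coe_det]
  have := hasDeg_det (M := (Matrix.of fun i j : Fin n =>
    completeInt (a i - ((i : ℕ) : ℤ) + ((j : ℕ) : ℤ))).map fun f => (f : SymHat ℚ))
    (r := fun i => a i - ((i : ℕ) : ℤ)) (c := fun j => ((j : ℕ) : ℤ))
    fun i j => hasDeg_completeInt _
  simpa [Finset.sum_sub_distrib] using this

theorem hasDeg_schurSeq (l : List ℕ) : HasDeg (schurSeq l : Sym) (l.sum : ℕ) := by
  have := hasDeg_jt fun i => (l.get i : ℤ)
  rw [schurSeq_eq_jt]
  convert this
  rw [← Nat.cast_sum]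
  congr 1
  simp

/-- Expansion of a Jacobi–Trudi determinant along a new first row. -/
theorem coeff_sig_mul_transl_jt {n : ℕ} (a : Fin n → ℤ) {m : ℤ} {e : ℕ+ →₀ ℕ}
    (he : (wt e : ℤ) = m + ∑ i, a i) :
    MvPowerSeries.coeff e (sig 1 * ((transl (-1) (jt a) : Sym) : SymHat ℚ)) =
      MvPowerSeries.coeff e ((jt (Fin.cons m a : Fin (n + 1) → ℤ) : Sym) : SymHat ℚ) := by
  let H : ℤ → SymHat ℚ := fun k => (completeInt k : Sym)
  -- `A` is the Jacobi–Trudi matrix of `(m, a)` with each entry of the first row replaced by all of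
  -- `σ₁`. Subtracting from each column its predecessor gives `B`.
  let A : Matrix (Fin (n + 1)) (Fin (n + 1)) (SymHat ℚ) := Matrix.of fun i j =>
    (Fin.cons (sig 1) fun i : Fin n => H (a i - ((i : ℕ) + 1 : ℤ) + (j : ℕ)) :
      Fin (n + 1) → SymHat ℚ) i
  let B : Matrix (Fin (n + 1)) (Fin (n + 1)) (SymHat ℚ) := Matrix.of fun i j =>
    (Fin.cons (A i 0) fun j : Fin n => A i j.succ - A i j.castSucc : Fin (n + 1) → SymHat ℚ) j
  have hAB : A.det = B.det := by
    refine Matrix.det_eq_of_forall_col_eq_smul_add_pred (fun _ => 1) (fun i => rfl) fun i j => ?_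
    simp [B]
  -- The first row of `B` is `(σ₁, 0, …, 0)`; below it the differences `h_k - h_{k-1}` are
  -- `h_k(X-1)`.
  have hB : B.det = sig 1 * ((transl (-1) (jt a) : Sym) : SymHat ℚ) := by
    rw [Matrix.det_succ_row_zero, Fin.sum_univ_succ, Finset.sum_eq_zero]
    · rw [Fin.val_zero, pow_zero, one_mul, add_zero, jt, AlgHom.map_det, coe_det]
      congr 2
      ext1 i j
      simp only [Matrix.submatrix_apply, Fin.zero_succAbove, Matrix.of_apply, Fin.cons_succ,
        Matrix.map_apply, AlgHom.mapMatrix_apply, transl_neg_one_completeInt, B, A, H,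
        Fin.val_succ, Fin.val_castSucc]
      rw [coe_sub]
      congr 3 <;> push_cast <;> ring_nf
    · intro j _
      simp [B, A]
  rw [← hB, ← hAB, jt, coe_det, Matrix.det_succ_row_zero, Matrix.det_succ_row_zero, map_sum,
    map_sum]
  refine Finset.sum_congr rfl fun j _ => ?_
  have hQ : ((Matrix.of fun i j : Fin (n + 1) => completeInt
      ((Fin.cons m a : Fin (n + 1) → ℤ) i - ((i : ℕ) : ℤ) + ((j : ℕ) : ℤ))).map
        fun f => (f : SymHat ℚ)).submatrix Fin.succ j.succAbove =
      A.submatrix Fin.succ j.succAbove := by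
    ext1 i k
    simp [A, H]
  rw [hQ]
  have hdeg := hasDeg_det (M := A.submatrix Fin.succ j.succAbove)
    (r := fun i => a i - ((i : ℕ) + 1 : ℤ)) (c := fun k => ((j.succAbove k : ℕ) : ℤ))
    fun i k => by simpa [A, H] using hasDeg_completeInt _
  have h1 := Fin.sum_univ_succAbove (fun k : Fin (n + 1) => ((k : ℕ) : ℤ)) j
  have h2 := Fin.sum_univ_succ (fun k : Fin (n + 1) => ((k : ℕ) : ℤ))
  simp only [Fin.val_zero, Fin.val_succ, Nat.cast_zero, Nat.cast_add, Nat.cast_one] at h2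
  -- The minor is homogeneous, so only the component `h_{m+j}` of `σ₁` contributes in the degree of
  -- `e`.
  refine hdeg.coeff_mul_congr fun b hb => ?_
  rw [Finset.sum_sub_distrib] at hb
  rw [coeff_neg_one_pow_mul, coeff_neg_one_pow_mul]
  congr 1
  simp only [A, Matrix.of_apply, Fin.cons_zero, Matrix.map_apply, MvPolynomial.coeff_coe,
    coeff_completeInt, coeff_sig]
  rw [if_pos (by simp only [Fin.val_zero]; omega)]
  simp

theorem constantCoeff_sig (c : ℚ) : MvPowerSeries.constantCoeff (sig c) = 1 := by
  rw [← MvPowerSeries.coeff_zero_eq_constantCoeff_apply, coeff_sig]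
  simp

theorem coeff_zero_transl_completeInt {k : ℤ} (hk : 0 ≤ k) :
    MvPolynomial.coeff 0 (transl 1 (completeInt k)) = 1 := by
  lift k to ℕ using hk
  induction k with
  | zero => rw [completeInt_natCast, complete_zero, map_one, MvPolynomial.coeff_zero_one]
  | succ k ih =>
    rw [transl_one_completeInt, MvPolynomial.coeff_add, coeff_completeInt, map_zero]
    push_cast
    rw [if_neg (by omega), add_sub_cancel_right, ih, zero_add]

/-- Expansion of a Jacobi–Trudi determinant along its first column. -/
theorem coeff_sig_neg_mul_transl_jt {n : ℕ} {b : Fin (n + 1) → ℤ} {m : ℤ} (h0 : 0 ≤ b 0)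
    (hm : b 0 ≤ m) (hb : ∀ i : Fin n, b i.succ - ((i : ℕ) + 1 : ℤ) < m) {e : ℕ+ →₀ ℕ}
    (he : (wt e : ℤ) + m = ∑ i, b i) :
    MvPowerSeries.coeff e (sig (-1) * ((transl 1 (jt b) : Sym) : SymHat ℚ)) =
      if m = b 0 then MvPowerSeries.coeff e ((jt (Fin.tail b) : Sym) : SymHat ℚ) else 0 := by
  let A : Matrix (Fin (n + 1)) (Fin (n + 1)) Sym := Matrix.of fun i j =>
    transl 1 (completeInt (b i - ((i : ℕ) : ℤ) + ((j : ℕ) : ℤ)))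
  -- Since `h_k(X+1) = h_k + h_{k-1}(X+1)`, subtracting from each column its predecessor leaves
  -- plain `h_k` outside the first column.
  let B : Matrix (Fin (n + 1)) (Fin (n + 1)) Sym := Matrix.of fun i j =>
    (Fin.cons (A i 0) fun j : Fin n => completeInt (b i - ((i : ℕ) : ℤ) + ((j : ℕ) + 1 : ℤ)) :
      Fin (n + 1) → Sym) j
  have hA : transl 1 (jt b) = A.det := by
    rw [jt, AlgHom.map_det]
    rfl
  have hAB : A.det = B.det := by
    refine Matrix.det_eq_of_forall_col_eq_smul_add_pred (fun _ => 1) (fun i => rfl) fun i j => ?_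
    simp only [A, B, Matrix.of_apply, Fin.cons_succ, one_mul, Fin.val_succ, Fin.val_castSucc]
    rw [transl_one_completeInt]
    push_cast
    congr 3
    ring
  rw [hA, hAB, coe_det, Matrix.det_succ_column_zero, Finset.mul_sum, map_sum]
  -- The minor of row `i` has degree `∑ b - b_i + i`, so the factor before it matters only in degree
  -- `b_i - i - m`. This is negative for `i > 0`, and for `i = 0` unless `m = b_0`, where only the
  -- constant term `1` remains.
  have hterm (i : Fin (n + 1)) (P' : SymHat ℚ)
      (hP : ∀ x, (wt x : ℤ) = b i - (i : ℕ) - m → MvPowerSeries.coeff x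
        ((-1) ^ (i : ℕ) * (sig (-1) * ((B i 0 : Sym) : SymHat ℚ))) = MvPowerSeries.coeff x P') :
      MvPowerSeries.coeff e (sig (-1) * ((-1) ^ (i : ℕ) * (B.map fun f => (f : SymHat ℚ)) i 0 *
        ((B.map fun f => (f : SymHat ℚ)).submatrix i.succAbove Fin.succ).det)) =
      MvPowerSeries.coeff e (P' *
        ((B.map fun f => (f : SymHat ℚ)).submatrix i.succAbove Fin.succ).det) := by
    have hdeg := hasDeg_det (M := (B.map fun f => (f : SymHat ℚ)).submatrix i.succAbove Fin.succ)
      (r := fun k => b (i.succAbove k) - ((i.succAbove k : ℕ) : ℤ)) (c := fun k => ((k : ℕ) + 1 : ℤ))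
      fun i k => by simpa [B] using hasDeg_completeInt _
    have h1 := Fin.sum_univ_succAbove (fun k : Fin (n + 1) => ((k : ℕ) : ℤ)) i
    have h2 := Fin.sum_univ_succ (fun k : Fin (n + 1) => ((k : ℕ) : ℤ))
    have h3 := Fin.sum_univ_succAbove b i
    simp only [Fin.val_zero, Fin.val_succ, Nat.cast_zero, Nat.cast_add, Nat.cast_one] at h2
    rw [show sig (-1) * ((-1) ^ (i : ℕ) * (B.map fun f => (f : SymHat ℚ)) i 0 *
        ((B.map fun f => (f : SymHat ℚ)).submatrix i.succAbove Fin.succ).det) =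
      (-1) ^ (i : ℕ) * (sig (-1) * ((B i 0 : Sym) : SymHat ℚ)) *
        ((B.map fun f => (f : SymHat ℚ)).submatrix i.succAbove Fin.succ).det by
      rw [Matrix.map_apply]; ring]
    refine hdeg.coeff_mul_congr fun x hx => hP x ?_
    rw [Finset.sum_sub_distrib] at hx
    omega
  rw [Fin.sum_univ_succ, Finset.sum_eq_zero, add_zero]
  · split_ifs with h
    · rw [hterm 0 1, one_mul, jt, coe_det]
      · congr 2
        ext1 i j
        simp only [Matrix.submatrix_apply, Fin.zero_succAbove, Matrix.of_apply, Fin.cons_succ,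
          Matrix.map_apply, Fin.val_succ, B, Fin.tail]
        congr 2
        push_cast
        ring
      · intro x hx
        obtain rfl : x = 0 := wt_eq_zero (by simp only [Fin.val_zero] at hx; omega)
        have h1 : MvPowerSeries.constantCoeff
            ((transl 1 (completeInt (b 0)) : Sym) : SymHat ℚ) = 1 := by
          rw [← MvPowerSeries.coeff_zero_eq_constantCoeff_apply, MvPolynomial.coeff_coe,
            coeff_zero_transl_completeInt h0]
        simp [B, A, constantCoeff_sig, h1]
    · rw [hterm 0 0, zero_mul, map_zero]
      intro x hx
      simp only [Fin.val_zero] at hx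
      omega
  · intro i _
    rw [hterm i.succ 0, zero_mul, map_zero]
    intro x hx
    have := hb i
    simp only [Fin.val_succ, Nat.cast_add, Nat.cast_one] at hx
    omega

theorem hall_congr_of_hasDeg {f : Sym} {d : ℤ} (hf : HasDeg f d) {F G : SymHat ℚ}
    (h : ∀ e, (wt e : ℤ) = d → MvPowerSeries.coeff e F = MvPowerSeries.coeff e G) :
    hall f F = hall f G :=
  hall_congr fun e he => h e (hf e (by rwa [MvPolynomial.coeff_coe]))

theorem hall_eq_zero_of_hasDeg {f g : Sym} {d d' : ℤ} (hf : HasDeg f d) (hg : HasDeg g d')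
    (h : d ≠ d') : hall f (g : SymHat ℚ) = 0 := by
  rw [hall_congr_of_hasDeg hf (G := 0), ← hallₗ_apply, map_zero]
  intro e he
  by_contra h0
  exact h (he ▸ hg e h0)

/-- Two adjunctions move `σ₁` and then the shift by `-1` from `σ₁ s_a(X-1)` to `g`. Thus `g ↦ sig
(-1) · g(X+1)` is adjoint to adding a first row. -/
theorem hall_jt_cons {n : ℕ} (a : Fin n → ℤ) {m : ℤ} {g : Sym} (hg : HasDeg g (m + ∑ i, a i)) :
    hall g ((jt (Fin.cons m a : Fin (n + 1) → ℤ) : Sym) : SymHat ℚ) =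
      hall (jt a) (sig (-1) * ((transl 1 g : Sym) : SymHat ℚ)) := by
  rw [← hall_congr_of_hasDeg hg fun e he => coeff_sig_mul_transl_jt a he, hall_sig_mul, hall_comm,
    ← hall_sig_mul]

/-! ## Orthonormality of the Schur functions -/

/-- The adjoint of adding a row `m`, applied to `s_{(n,b)}`, gives `s_b` for `m = n` and `0` for `m
> n` in the relevant degree. -/
theorem hall_schurSeq_cons_cons {m n : ℕ} (a : List ℕ) {b : List ℕ} (hnm : n ≤ m)
    (hb : ∀ x ∈ b, x ≤ n) :
    hall (R := ℚ) (schurSeq (m :: a)) (schurSeq (n :: b) : Sym) =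
      if m = n then hall (R := ℚ) (schurSeq a) (schurSeq b : Sym) else 0 := by
  by_cases hs : (m :: a).sum = (n :: b).sum
  · have hg : HasDeg (schurSeq (n :: b) : Sym) ((m : ℤ) + ∑ i, ((a.get i : ℕ) : ℤ)) := by
      have h1 : (m : ℤ) + ∑ i, ((a.get i : ℕ) : ℤ) = ((m :: a).sum : ℕ) := by
        simp [List.sum_cons, ← Nat.cast_sum]
      rw [h1, hs]
      exact hasDeg_schurSeq _
    have hsum : (m : ℤ) + ∑ i, ((a.get i : ℕ) : ℤ) = n + ∑ i, ((b.get i : ℕ) : ℤ) := by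
      simp only [List.sum_cons] at hs
      simp only [List.get_eq_getElem, ← Nat.cast_sum, Fin.sum_univ_getElem]
      exact_mod_cast hs
    have key : ∀ e, (wt e : ℤ) = ∑ i, ((a.get i : ℕ) : ℤ) →
        MvPowerSeries.coeff e (sig (-1) * ((transl 1 (schurSeq (n :: b)) : Sym) : SymHat ℚ)) =
          MvPowerSeries.coeff e
            (if m = n then ((schurSeq b : Sym) : SymHat ℚ) else 0) := by
      intro e he
      rw [schurSeq_cons, coeff_sig_neg_mul_transl_jt (m := m)]
      · simp only [Fin.cons_zero, Nat.cast_inj]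
        split_ifs
        · rfl
        · simp
      · simp
      · simpa using hnm
      · intro i
        have := hb _ (List.get_mem b i)
        rw [Fin.cons_succ]
        omega
      · rw [Fin.sum_univ_succ]
        simp only [Fin.cons_zero, Fin.cons_succ]
        omega
    rw [hall_comm, schurSeq_cons m a, hall_jt_cons _ hg, hall_congr_of_hasDeg (hasDeg_jt _) key]
    split_ifs
    · rfl
    · rw [← hallₗ_apply, map_zero]
  · rw [hall_eq_zero_of_hasDeg (hasDeg_schurSeq _) (hasDeg_schurSeq _) (by exact_mod_cast hs)]
    split_ifs with h
    · subst h
      rw [hall_eq_zero_of_hasDeg (hasDeg_schurSeq a) (hasDeg_schurSeq b)]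
      simp only [List.sum_cons] at hs
      intro h; exact hs (by omega)
    · rfl

theorem schurSeq_nil : schurSeq [] = 1 := by
  simp [schurSeq]

theorem hall_one_one : hall 1 ((1 : Sym) : SymHat ℚ) = 1 := by
  rw [← MvPolynomial.C_1, MvPolynomial.C_apply, hall_monomial, MvPolynomial.coeff_coe]
  simp

theorem hall_schurSeq {a b : List ℕ} (ha : a.Pairwise (· ≥ ·)) (hb : b.Pairwise (· ≥ ·))
    (ha0 : ∀ x ∈ a, 0 < x) (hb0 : ∀ x ∈ b, 0 < x) :
    hall (R := ℚ) (schurSeq a) (schurSeq b : Sym) = if a = b then 1 else 0 := by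
  induction a generalizing b with
  | nil =>
    cases b with
    | nil => simpa [schurSeq_nil] using hall_one_one
    | cons n b =>
      rw [hall_eq_zero_of_hasDeg (hasDeg_schurSeq _) (hasDeg_schurSeq _)]
      · simp
      · have := hb0 n List.mem_cons_self
        simp only [List.sum_cons, List.sum_nil]
        omega
  | cons m a ih =>
    cases b with
    | nil =>
      rw [hall_eq_zero_of_hasDeg (hasDeg_schurSeq _) (hasDeg_schurSeq _)]
      · simp
      · have := ha0 m List.mem_cons_self
        simp only [List.sum_cons, List.sum_nil]
        omega
    | cons n b =>
      rw [List.pairwise_cons] at ha hb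
      rcases le_or_gt n m with h | h
      · rw [hall_schurSeq_cons_cons a h hb.1, ih ha.2 hb.2 (fun x hx => ha0 x (by simp [hx]))
          fun x hx => hb0 x (by simp [hx])]
        by_cases hmn : m = n <;> simp [hmn]
      · rw [hall_comm, hall_schurSeq_cons_cons b h.le ha.1, if_neg h.ne', if_neg]
        intro h'
        exact h.ne (List.cons.inj h').1

theorem hall_schur (μ ν : YoungDiagram) [Decidable (μ = ν)] :
    hall (R := ℚ) (schur μ) (schur ν : Sym) = if μ = ν then 1 else 0 := by
  rw [schur, schur, hall_schurSeq μ.rowLens_sorted.pairwise ν.rowLens_sorted.pairwise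
    μ.pos_of_mem_rowLens ν.pos_of_mem_rowLens]
  have : μ.rowLens = ν.rowLens ↔ μ = ν := by
    refine ⟨fun h => YoungDiagram.equivListRowLens.injective (Subtype.ext h), fun h => h ▸ rfl⟩
  simp only [this]

/-! ## Conjugate partitions -/

/-- The new last row of the matrix is `(0, …, 0, h_0)`. -/
theorem schurSeq_append_zero (l : List ℕ) : schurSeq (l ++ [0]) = schurSeq l := by
  have hlen : (l ++ [0]).length = l.length + 1 := by simp
  rw [schurSeq, ← Matrix.det_reindex_self (finCongr hlen), Matrix.det_succ_row _ (Fin.last _),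
    Fin.sum_univ_castSucc, Finset.sum_eq_zero, zero_add]
  · rw [schurSeq]
    simp only [Fin.val_last, Even.neg_one_pow (Even.add_self _), Fin.succAbove_last, one_mul]
    simp [complete_zero, completeInt]
    congr 1
    ext1 i j
    simp
  · intro j _
    simp [completeInt]

theorem schurSeq_append_replicate_zero (l : List ℕ) (k : ℕ) :
    schurSeq (l ++ List.replicate k 0) = schurSeq l := by
  induction k with
  | zero => simp
  | succ k ih => rw [List.replicate_succ', ← List.append_assoc, schurSeq_append_zero, ih]

theorem coeff_coe_antip (f : Sym) (e : ℕ+ →₀ ℕ) :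
    MvPowerSeries.coeff e ((antip f : Sym) : SymHat ℚ) =
      (-1) ^ e.degree * MvPowerSeries.coeff e (f : SymHat ℚ) := by
  rw [MvPolynomial.coeff_coe, MvPolynomial.coeff_coe, coeff_antip]

theorem HasDeg.antip {f : Sym} {d : ℤ} (hf : HasDeg f d) : HasDeg (antip f : Sym) d := fun e he => by
  rw [coeff_coe_antip] at he
  exact hf e (right_ne_zero_of_mul he)

/-- On series the antipode is the sign `(-1) ^ e.degree` on coefficients; it is multiplicative and
exchanges `sig c` with `sig (-c)`. -/
theorem coeff_sig_neg_mul_antip (c : ℚ) (f : Sym) (e : ℕ+ →₀ ℕ) :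
    MvPowerSeries.coeff e (sig (-c) * ((antip f : Sym) : SymHat ℚ)) =
      (-1) ^ e.degree * MvPowerSeries.coeff e (sig c * (f : SymHat ℚ)) := by
  classical
  rw [MvPowerSeries.coeff_mul, MvPowerSeries.coeff_mul, Finset.mul_sum]
  refine Finset.sum_congr rfl fun x hx => ?_
  rw [coeff_coe_antip, coeff_sig, coeff_sig, ← Finset.HasAntidiagonal.mem_antidiagonal.1 hx,
    map_add, neg_pow, pow_add]
  ring

/-- Adding a first row to one partition and a first column to the other. -/
theorem hall_schurSeq_cons_antip (a k : List ℕ) (hs : a.sum = k.sum) :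
    hall (R := ℚ) (schurSeq (k.length :: a)) (antip (schurSeq (k.map (· + 1))) : Sym) =
      (-1) ^ k.length * hall (R := ℚ) (schurSeq a) (antip (schurSeq k) : Sym) := by
  set g := schurSeq (k.map (· + 1)) with hgdef
  let b : Fin k.length → ℤ := fun i => (k.get i : ℤ) + 1
  have hg' : g = jt b := by
    have hlen : (k.map (· + 1)).length = k.length := by simp
    rw [hgdef, schurSeq, ← Matrix.det_reindex_self (finCongr hlen), jt]
    congr 1
    ext1 i j
    simp [b]
  have hsum : (∑ i, ((k.get i : ℕ) : ℤ)) = ∑ i, ((a.get i : ℕ) : ℤ) := by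
    simp only [List.get_eq_getElem, ← Nat.cast_sum, Fin.sum_univ_getElem, hs]
  have hbsum : ∑ i, b i = (k.length : ℤ) + ∑ i, ((a.get i : ℕ) : ℤ) := by
    simp only [b, Finset.sum_add_distrib, hsum]
    simp [add_comm]
  have hg : HasDeg g ((k.length : ℤ) + ∑ i, ((a.get i : ℕ) : ℤ)) := by
    rw [hg', ← hbsum]
    exact hasDeg_jt b
  -- With `r = k.length`, the first row is `(h_{-r}, …, h_{-1}, h_0) = (0, …, 0, 1)`, whence the
  -- sign; the remaining minor is the Jacobi–Trudi matrix of `k`.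
  have hcons : jt (Fin.cons (-(k.length : ℤ)) b : Fin (k.length + 1) → ℤ) =
      (-1 : ℚ) ^ k.length • schurSeq k := by
    have hsm : (-1 : ℚ) ^ k.length • schurSeq k = (-1) ^ k.length * schurSeq k := by
      rw [MvPolynomial.smul_eq_C_mul, map_pow, map_neg, map_one]
    rw [hsm]
    rw [jt, Matrix.det_succ_row_zero, Fin.sum_univ_castSucc, Finset.sum_eq_zero, zero_add]
    · simp only [Fin.val_last, Matrix.of_apply, Fin.cons_zero, Fin.val_zero, Fin.succAbove_last]
      rw [show (-(k.length : ℤ) - ((0 : ℕ) : ℤ) + k.length) = ((0 : ℕ) : ℤ) by simp,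
        completeInt_natCast, complete_zero, mul_one, schurSeq]
      congr 2
      ext1 i j
      simp only [Matrix.submatrix_apply, Matrix.of_apply, Fin.cons_succ, Fin.val_succ,
        Fin.val_castSucc, b]
      congr 1
      push_cast
      ring
    · intro j _
      simp only [Matrix.of_apply, Fin.cons_zero, Fin.val_zero, Fin.val_castSucc]
      rw [completeInt_of_neg (by have := j.2; omega), mul_zero, zero_mul]
  -- Removing a row from `antip g` is the antipode of adding a row to `g`; comparing degrees, the
  -- added row has the negative length `-k.length`.
  have key : ∀ e, (wt e : ℤ) = ∑ i, ((a.get i : ℕ) : ℤ) →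
      MvPowerSeries.coeff e (sig (-1) * ((transl 1 (antip g) : Sym) : SymHat ℚ)) =
        MvPowerSeries.coeff e ((-1 : ℚ) ^ k.length • ((antip (schurSeq k) : Sym) : SymHat ℚ)) := by
    intro e he
    rw [transl_antip, coeff_sig_neg_mul_antip, hg', coeff_sig_mul_transl_jt b
      (m := -(k.length : ℤ)) (by rw [he, hbsum]; ring), hcons, ← coeff_coe_antip, map_smul,
      MvPolynomial.coeff_coe, MvPolynomial.coeff_smul, map_smul, MvPolynomial.coeff_coe]
  rw [hall_comm, schurSeq_cons, hall_jt_cons _ hg.antip, hall_congr_of_hasDeg (hasDeg_jt _) key,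
    ← schurSeq_eq_jt, hall_smul_right, smul_eq_mul]

/-- The first `m` columns of the partition with rows `l`. -/
def conj (l : List ℕ) (m : ℕ) : List ℕ := (List.range m).map fun j => l.countP (j < ·)

/-- A longest row `x` adds one box to each of the first `x` columns, and all later columns are
empty. -/
theorem conj_cons {x m : ℕ} {l : List ℕ} (hl : ∀ y ∈ l, y ≤ x) (hx : x ≤ m) :
    conj (x :: l) m = (conj l x).map (· + 1) ++ List.replicate (m - x) 0 := by
  obtain ⟨d, rfl⟩ := Nat.exists_eq_add_of_le hx
  rw [conj, List.range_add, List.map_append, conj, List.map_map, List.map_map, Nat.add_sub_cancel_left]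
  congr 1
  · refine List.map_congr_left fun j hj => ?_
    simp [List.mem_range.1 hj]
  · rw [List.eq_replicate_iff]
    refine ⟨by simp, fun y hy => ?_⟩
    obtain ⟨j, -, rfl⟩ := List.mem_map.1 hy
    simp only [Function.comp_apply, List.countP_eq_zero, List.mem_cons, decide_eq_true_eq]
    rintro z (rfl | hz)
    · omega
    · have := hl z hz; omega

theorem sum_conj {m : ℕ} {l : List ℕ} (hl : l.Pairwise (· ≥ ·)) (hm : ∀ y ∈ l, y ≤ m) :
    (conj l m).sum = l.sum := by
  induction l generalizing m with
  | nil => simp [conj]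
  | cons x l ih =>
    rw [List.pairwise_cons] at hl
    rw [conj_cons hl.1 (hm x List.mem_cons_self), List.sum_append, List.sum_map_add, List.map_id',
      ih hl.2 hl.1, List.map_const']
    simp [conj, add_comm]

theorem hall_schurSeq_antip_conj {m : ℕ} {l : List ℕ} (hl : l.Pairwise (· ≥ ·))
    (hm : ∀ y ∈ l, y ≤ m) :
    hall (R := ℚ) (schurSeq l) (antip (schurSeq (conj l m)) : Sym) = (-1) ^ l.sum := by
  induction l generalizing m with
  | nil =>
    have : conj [] m = [] ++ List.replicate m 0 := by
      simp [conj]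
    rw [this, schurSeq_append_replicate_zero, schurSeq_nil, map_one, hall_one_one]
    simp
  | cons x l ih =>
    rw [List.pairwise_cons] at hl
    have h := hall_schurSeq_cons_antip l (conj l x) (sum_conj hl.2 hl.1).symm
    rw [show (conj l x).length = x by simp [conj], ih hl.2 hl.1] at h
    rw [conj_cons hl.1 (hm x List.mem_cons_self), schurSeq_append_replicate_zero, h, List.sum_cons,
      pow_add]

theorem rowLens_transpose (μ : YoungDiagram) : μ.transpose.rowLens = conj μ.rowLens (μ.rowLen 0) := by
  rw [YoungDiagram.rowLens, conj, YoungDiagram.colLen_transpose]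
  refine List.map_congr_left fun j _ => ?_
  rw [YoungDiagram.rowLen_transpose, YoungDiagram.rowLens, List.countP_map]
  have h : ∀ i, i < μ.colLen j ↔ j < μ.rowLen i := fun i => by
    rw [← YoungDiagram.mem_iff_lt_colLen, YoungDiagram.mem_iff_lt_rowLen]
  have hle := μ.colLen_anti 0 j (Nat.zero_le _)
  obtain ⟨d, hd⟩ := Nat.exists_eq_add_of_le hle
  rw [hd, List.range_add, List.countP_append, List.countP_eq_length.2, List.countP_eq_zero.2]
  · simp
  · intro i hi
    obtain ⟨i, -, rfl⟩ := List.mem_map.1 hi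
    simp [← h]
  · intro i hi
    simpa [← h] using hi

theorem sum_rowLens (μ : YoungDiagram) : μ.rowLens.sum = μ.card := by
  have h : μ.card = ∑ i ∈ Finset.range (μ.colLen 0), μ.rowLen i := by
    rw [YoungDiagram.card, Finset.card_eq_sum_card_fiberwise (f := Prod.fst)
      (t := Finset.range (μ.colLen 0))]
    · exact Finset.sum_congr rfl fun i _ => (μ.rowLen_eq_card).symm
    · rintro ⟨i, j⟩ hc
      have h1 : (i, 0) ∈ μ := μ.up_left_mem le_rfl (Nat.zero_le j) hc
      simpa [YoungDiagram.mem_iff_lt_colLen] using h1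
  rw [h]
  rfl

/-- The antipode conjugates Schur functions. -/
theorem antip_schur_transpose (μ : YoungDiagram) :
    antip (schur μ.transpose) = (-1 : ℚ) ^ μ.card • schur μ := by
  classical
  set f := schur μ
  set g := antip (schur μ.transpose)
  set c : ℚ := (-1) ^ μ.card with hc
  have hcc : c * c = 1 := by rw [hc, ← mul_pow]; simp
  have h1 : hall (R := ℚ) f (g : Sym) = c := by
    simp only [f, g, schur]
    rw [rowLens_transpose, hall_schurSeq_antip_conj μ.rowLens_sorted.pairwise, sum_rowLens]
    intro y hy
    simp only [YoungDiagram.rowLens, List.mem_map] at hy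
    obtain ⟨i, -, rfl⟩ := hy
    exact μ.rowLen_anti 0 i (Nat.zero_le i)
  have h2 : hall (R := ℚ) g (g : Sym) = 1 := by
    rw [hall_antip_antip, hall_schur, if_pos rfl]
  have h3 : hall (R := ℚ) f (f : Sym) = 1 := by rw [hall_schur, if_pos rfl]
  -- Two unit vectors with scalar product `c = ±1`: the squared norm of `g - c f` is `1 - 2c² + c² =
  -- 0`.
  have key : hall (R := ℚ) (g - c • f) ((g - c • f : Sym) : SymHat ℚ) = 0 := by
    have hs : ((c • f : Sym) : SymHat ℚ) = c • (f : SymHat ℚ) := by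
      ext e; simp
    rw [coe_sub, hs, ← hallₗ_apply]
    simp only [map_sub, LinearMap.sub_apply, map_smul, LinearMap.smul_apply, hallₗ_apply, h1, h2,
      h3, hall_comm g f, smul_eq_mul]
    linear_combination (-1 : ℚ) * hcc
  exact sub_eq_zero.1 (hall_self_eq_zero key)

/-! ## The Schur basis -/

/-- The linear combination of Schur functions with given coefficients. -/
noncomputable def schurSum : (YoungDiagram →₀ ℚ) →ₗ[ℚ] Sym := Finsupp.linearCombination ℚ schur

theorem schurSum_apply (b : YoungDiagram →₀ ℚ) : schurSum b = b.sum fun μ a => a • schur μ := rfl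

theorem coe_smul' (c : ℚ) (f : Sym) : ((c • f : Sym) : SymHat ℚ) = c • (f : SymHat ℚ) := by
  ext e; simp

/-- The Hall scalar product of two symmetric functions. -/
noncomputable def hallForm : Sym →ₗ[ℚ] Sym →ₗ[ℚ] ℚ :=
  LinearMap.mk₂ ℚ (fun f g => hall (R := ℚ) f (g : SymHat ℚ)) (fun f g h => hall_add_left f g _)
    (fun c f g => hall_smul_left c f _)
    (fun f g h => by rw [MvPolynomial.coe_add, hall_add_right])
    fun c f g => by rw [coe_smul', hall_smul_right]

theorem hallForm_apply (f g : Sym) : hallForm f g = hall (R := ℚ) f (g : SymHat ℚ) := rfl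

theorem hallForm_schurSum (μ : YoungDiagram) (b : YoungDiagram →₀ ℚ) :
    hallForm (schur μ) (schurSum b) = b μ := by
  classical
  rw [schurSum_apply, Finsupp.sum, map_sum]
  simp only [map_smul, hallForm_apply, hall_schur, smul_eq_mul, mul_ite, mul_one, mul_zero]
  rw [Finset.sum_ite_eq]
  simp +contextual [eq_comm]

/-- In degree `n` the Schur functions are orthonormal, hence independent, and they are as many as
the power-sum products, both being indexed by the partitions of `n`. -/
theorem exists_schurSum_component (f : Sym) (n : ℕ) :
    ∃ b, ∀ e, (schurSum b).coeff e = if wt e = n then f.coeff e else 0 := by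
  classical
  let l : n.Partition → List ℕ := fun ν => ν.parts.sort (· ≥ ·)
  have hl (ν : n.Partition) : (l ν).Pairwise (· ≥ ·) := Multiset.pairwise_sort _ _
  have hpos (ν : n.Partition) : ∀ x ∈ l ν, 0 < x := fun x hx =>
    ν.parts_pos ((Multiset.mem_sort _).1 hx)
  have hsum (ν : n.Partition) : (l ν).sum = n := by
    rw [← ν.parts_sum, ← Multiset.sum_coe, Multiset.sort_eq]
  have hinj : Function.Injective l := fun ν ν' h => by
    ext1
    rw [← Multiset.sort_eq ν.parts (· ≥ ·), ← Multiset.sort_eq ν'.parts (· ≥ ·)]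
    exact congrArg _ h
  let φ : n.Partition → YoungDiagram := fun ν => YoungDiagram.ofRowLens (l ν) (hl ν).sortedGE
  have hφ (ν : n.Partition) : schur (φ ν) = schurSeq (l ν) := by
    rw [schur, YoungDiagram.rowLens_ofRowLens_eq_self (hpos ν)]
  let B : (n.Partition → ℚ) →ₗ[ℚ] (YoungDiagram →₀ ℚ) :=
    ∑ ν, (LinearMap.proj ν).smulRight (Finsupp.single (φ ν) (1 : ℚ))
  have hB (b : n.Partition → ℚ) : schurSum (B b) = ∑ ν, b ν • schurSeq (l ν) := by
    simp [B, schurSum, hφ]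
  have hdeg (b : n.Partition → ℚ) (e : ℕ+ →₀ ℕ) (he : wt e ≠ n) :
      (schurSum (B b)).coeff e = 0 := by
    rw [hB, MvPolynomial.coeff_sum]
    refine Finset.sum_eq_zero fun ν _ => ?_
    rw [MvPolynomial.coeff_smul]
    by_contra h0
    have := hasDeg_schurSeq (l ν) e (by
      rw [MvPolynomial.coeff_coe]; exact right_ne_zero_of_mul h0)
    rw [hsum] at this
    exact he (by exact_mod_cast this)
  let K : Sym →ₗ[ℚ] (n.Partition → ℚ) :=
    LinearMap.pi fun ν => MvPolynomial.lcoeff ℚ (expo ν)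
  have hKB : Function.Injective (K ∘ₗ schurSum ∘ₗ B) := by
    rw [← LinearMap.ker_eq_bot, LinearMap.ker_eq_bot']
    intro b hb
    have h0 : schurSum (B b) = 0 := by
      ext e
      by_cases he : wt e = n
      · obtain ⟨ν, rfl⟩ := exists_expo e he
        exact congrFun hb ν
      · rw [hdeg b e he, MvPolynomial.coeff_zero]
    funext ν
    have h1 : hallForm (schurSeq (l ν)) (schurSum (B b)) = b ν := by
      rw [hB, map_sum]
      simp [hallForm_apply, hall_schurSeq (hl _) (hl _) (hpos _) (hpos _), hinj.eq_iff]
    rw [← h1, h0, map_zero, Pi.zero_apply]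
  obtain ⟨b, hb⟩ := LinearMap.injective_iff_surjective.1 hKB (K f)
  refine ⟨B b, fun e => ?_⟩
  split_ifs with he
  · obtain ⟨ν, rfl⟩ := exists_expo e he
    exact congrFun hb ν
  · exact hdeg b e he

theorem schurSum_surjective : Function.Surjective schurSum := by
  classical
  intro f
  choose b hb using exists_schurSum_component f
  refine ⟨∑ n ∈ f.support.image wt, b n, ?_⟩
  ext e
  rw [map_sum, MvPolynomial.coeff_sum]
  simp only [hb]
  rw [Finset.sum_ite_eq]
  split_ifs with h
  · rfl
  · by_contra h0
    exact h (Finset.mem_image_of_mem _ (MvPolynomial.mem_support_iff.2 (Ne.symm h0)))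

theorem existsUnique_schurSum (f : Sym) :
    ∃! b : YoungDiagram →₀ ℚ, f = b.sum fun μ a => a • schur μ := by
  obtain ⟨b, rfl⟩ := schurSum_surjective f
  refine ⟨b, rfl, fun b' hb' => ?_⟩
  ext μ
  rw [← hallForm_schurSum μ b', ← hallForm_schurSum μ b, hb', schurSum_apply]

/-! ## The degree derivation -/

/-- The derivation multiplying the component of degree `n` by `n`. -/
noncomputable def euler : SymHat ℚ →ₗ[ℚ] SymHat ℚ where
  toFun F := fun e => wt e * F e
  map_add' F G := by funext e; exact mul_add _ _ _
  map_smul' c F := by funext e; exact mul_left_comm _ _ _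

theorem coeff_euler (F : SymHat ℚ) (e : ℕ+ →₀ ℕ) :
    MvPowerSeries.coeff e (euler F) = wt e * MvPowerSeries.coeff e F := rfl

theorem euler_mul (F G : SymHat ℚ) : euler (F * G) = euler F * G + F * euler G := by
  classical
  ext e
  rw [map_add, coeff_euler, MvPowerSeries.coeff_mul, MvPowerSeries.coeff_mul,
    MvPowerSeries.coeff_mul, Finset.mul_sum, ← Finset.sum_add_distrib]
  refine Finset.sum_congr rfl fun x hx => ?_
  rw [coeff_euler, coeff_euler, ← Finset.HasAntidiagonal.mem_antidiagonal.1 hx, map_add]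
  push_cast
  ring

theorem euler_C (c : ℚ) : euler (MvPowerSeries.C c) = 0 := by
  classical
  ext e
  rw [coeff_euler, MvPowerSeries.coeff_C]
  split_ifs with h
  · simp [h]
  · simp

theorem euler_X (k : ℕ+) : euler (MvPowerSeries.X k) = ((k : ℕ) : ℚ) • MvPowerSeries.X k := by
  classical
  ext e
  rw [coeff_euler, map_smul, MvPowerSeries.coeff_X, smul_eq_mul]
  split_ifs with h
  · simp [h]
  · simp

/-- A linear differential equation for `euler` has at most one solution with given constant
coefficient. -/
theorem eq_of_euler_eq {A F G : SymHat ℚ} (hA : MvPowerSeries.coeff 0 A = 0) (hF : euler F = A * F)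
    (hG : euler G = A * G) (h0 : MvPowerSeries.coeff 0 F = MvPowerSeries.coeff 0 G) : F = G := by
  classical
  have key : ∀ n, ∀ e, wt e = n → MvPowerSeries.coeff e F = MvPowerSeries.coeff e G := by
    intro n
    induction n using Nat.strong_induction_on with
    | _ n ih =>
      intro e he
      rcases Nat.eq_zero_or_pos n with rfl | hn
      · rw [wt_eq_zero he, h0]
      · have h1 : (wt e : ℚ) * MvPowerSeries.coeff e F = wt e * MvPowerSeries.coeff e G := by
          rw [← coeff_euler, ← coeff_euler, hF, hG, MvPowerSeries.coeff_mul,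
            MvPowerSeries.coeff_mul]
          refine Finset.sum_congr rfl fun x hx => ?_
          -- The unknown of full degree is multiplied by the constant term of `A`, which is `0`; the
          -- other terms have lower degree.
          by_cases hx1 : x.1 = 0
          · rw [hx1, hA, zero_mul, zero_mul]
          · have h2 : wt x.1 + wt x.2 = wt e := by
              rw [← map_add, Finset.HasAntidiagonal.mem_antidiagonal.1 hx]
            have h3 := mt wt_eq_zero hx1
            rw [ih (wt x.2) (by omega) x.2 rfl]
        exact mul_left_cancel₀ (by rw [he]; exact_mod_cast hn.ne') h1
  ext e
  exact key _ e rfl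

/-! ### Truncation and order of series, and the chain rule -/

/-- Agreement of two series up to degree `n`. -/
def EqUpTo (n : ℕ) (F G : SymHat ℚ) : Prop :=
  ∀ e, wt e ≤ n → MvPowerSeries.coeff e F = MvPowerSeries.coeff e G

theorem EqUpTo.refl (n : ℕ) (F : SymHat ℚ) : EqUpTo n F F := fun _ _ => rfl

theorem EqUpTo.add {n : ℕ} {F G F' G' : SymHat ℚ} (h : EqUpTo n F G) (h' : EqUpTo n F' G') :
    EqUpTo n (F + F') (G + G') := fun e he => by rw [map_add, map_add, h e he, h' e he]

theorem EqUpTo.mul {n : ℕ} {F G F' G' : SymHat ℚ} (h : EqUpTo n F G) (h' : EqUpTo n F' G') :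
    EqUpTo n (F * F') (G * G') := fun e he => by
  classical
  rw [MvPowerSeries.coeff_mul, MvPowerSeries.coeff_mul]
  refine Finset.sum_congr rfl fun x hx => ?_
  have h2 : wt x.1 + wt x.2 = wt e := by
    rw [← map_add, Finset.HasAntidiagonal.mem_antidiagonal.1 hx]
  rw [h _ (by omega), h' _ (by omega)]

theorem EqUpTo.euler {n : ℕ} {F G : SymHat ℚ} (h : EqUpTo n F G) : EqUpTo n (euler F) (euler G) :=
  fun e he => by rw [coeff_euler, coeff_euler, h e he]

theorem EqUpTo.sum {ι : Type*} {n : ℕ} {s : Finset ι} {F G : ι → SymHat ℚ}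
    (h : ∀ i ∈ s, EqUpTo n (F i) (G i)) : EqUpTo n (∑ i ∈ s, F i) (∑ i ∈ s, G i) := fun e he => by
  rw [map_sum, map_sum]
  exact Finset.sum_congr rfl fun i hi => h i hi e he

/-- The series `F` has no components of degree less than `k`. -/
def OrdGE (k : ℕ) (F : SymHat ℚ) : Prop := ∀ e, wt e < k → MvPowerSeries.coeff e F = 0

theorem EqUpTo.mul_ordGE {n k : ℕ} {F G H : SymHat ℚ} (h : EqUpTo (n - k) F G) (hH : OrdGE k H) :
    EqUpTo n (F * H) (G * H) := fun e he => by
  classical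
  rw [MvPowerSeries.coeff_mul, MvPowerSeries.coeff_mul]
  refine Finset.sum_congr rfl fun x hx => ?_
  have h2 : wt x.1 + wt x.2 = wt e := by
    rw [← map_add, Finset.HasAntidiagonal.mem_antidiagonal.1 hx]
  rcases lt_or_ge (wt x.2) k with h3 | h3
  · rw [hH _ h3, mul_zero, mul_zero]
  · rw [h _ (by omega)]

theorem OrdGE.mul {j k : ℕ} {F G : SymHat ℚ} (hF : OrdGE j F) (hG : OrdGE k G) :
    OrdGE (j + k) (F * G) := fun e he => by
  classical
  rw [MvPowerSeries.coeff_mul]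
  refine Finset.sum_eq_zero fun x hx => ?_
  have h2 : wt x.1 + wt x.2 = wt e := by
    rw [← map_add, Finset.HasAntidiagonal.mem_antidiagonal.1 hx]
  rcases lt_or_ge (wt x.1) j with h3 | h3
  · rw [hF _ h3, zero_mul]
  · rw [hG _ (by omega), mul_zero]

theorem OrdGE.pow {j : ℕ} {F : SymHat ℚ} (hF : OrdGE j F) (n : ℕ) : OrdGE (n * j) (F ^ n) := by
  induction n with
  | zero => intro e he; simp at he
  | succ n ih => rw [pow_succ, add_mul, one_mul]; exact ih.mul hF

theorem OrdGE.smul {j : ℕ} {F : SymHat ℚ} (hF : OrdGE j F) (c : ℚ) : OrdGE j (c • F) :=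
  fun e he => by rw [map_smul, hF e he, smul_zero]

theorem OrdGE.euler {j : ℕ} {F : SymHat ℚ} (hF : OrdGE j F) : OrdGE j (euler F) :=
  fun e he => by rw [coeff_euler, hF e he, mul_zero]

/-- Only the index `j` contributes. If `j > n` it is absent from the sum, but then `α p_j` starts in
degree `j` and is invisible up to degree `n`. -/
theorem sum_pderiv_X {α : Sym →ₐ[ℚ] SymHat ℚ}
    (ha : ∀ k : ℕ+, OrdGE (k : ℕ) (α (MvPolynomial.X k))) (n : ℕ) (j : ℕ+) :
    EqUpTo n (∑ i ∈ Finset.range n, α (MvPolynomial.pderiv i.succPNat (MvPolynomial.X j)) *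
      euler (α (MvPolynomial.X i.succPNat))) (euler (α (MvPolynomial.X j))) := by
  classical
  have h0 (i : ℕ) (hi : i.succPNat ≠ j) :
      α (MvPolynomial.pderiv i.succPNat (MvPolynomial.X j)) *
        euler (α (MvPolynomial.X i.succPNat)) = 0 := by
    rw [MvPolynomial.pderiv_X_of_ne hi.symm, map_zero, zero_mul]
  by_cases hj : (j : ℕ) ≤ n
  · rw [Finset.sum_eq_single_of_mem j.natPred
      (by have := j.natPred_add_one; rw [Finset.mem_range]; omega)]
    · rw [PNat.succPNat_natPred, MvPolynomial.pderiv_X_self, map_one, one_mul]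
      exact EqUpTo.refl _ _
    · intro i _ hi
      refine h0 i ?_
      rintro rfl
      exact hi (by simp)
  · intro e he
    rw [(ha j).euler e (by omega), Finset.sum_eq_zero, map_zero]
    intro i hi
    refine h0 i ?_
    rintro rfl
    rw [Finset.mem_range] at hi
    rw [Nat.succPNat_coe] at hj
    omega

/-- The chain rule for `euler`, up to degree `n`. -/
theorem euler_algHom {α : Sym →ₐ[ℚ] SymHat ℚ}
    (ha : ∀ k : ℕ+, OrdGE (k : ℕ) (α (MvPolynomial.X k))) (n : ℕ) (f : Sym) :
    EqUpTo n (∑ i ∈ Finset.range n, α (MvPolynomial.pderiv i.succPNat f) *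
      euler (α (MvPolynomial.X i.succPNat))) (euler (α f)) := by
  induction f using MvPolynomial.induction_on with
  | C c =>
    have : α (MvPolynomial.C c) = MvPowerSeries.C c := α.commutes c
    simp only [this, euler_C, MvPolynomial.pderiv_C, map_zero, zero_mul, Finset.sum_const_zero]
    exact EqUpTo.refl _ _
  | add f g hf hg =>
    simp only [map_add, add_mul, Finset.sum_add_distrib]
    exact hf.add hg
  | mul_X f j hf =>
    have h1 := ((EqUpTo.refl n (α f)).mul (sum_pderiv_X ha n j)).add
      ((EqUpTo.refl n (α (MvPolynomial.X j))).mul hf)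
    rw [Finset.mul_sum, Finset.mul_sum, ← Finset.sum_add_distrib] at h1
    rw [map_mul, euler_mul, mul_comm (euler _), add_comm]
    refine Eq.mp (congrArg (fun F => EqUpTo n F _) (Finset.sum_congr rfl fun i _ => ?_)) h1
    rw [Derivation.leibniz, map_add, smul_eq_mul, smul_eq_mul, map_mul, map_mul, add_mul, mul_assoc,
      mul_assoc]

/-! ## The Lie series -/

/-- The `k`-th Adams operation on series with rational coefficients. -/
noncomputable def adams (k : ℕ+) : SymHat ℚ →ₐ[ℚ] SymHat ℚ := MvPowerSeries.rename fun j => k * j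

theorem psiHat_id (k : ℕ+) (F : SymHat ℚ) : psiHat (RingHom.id ℚ) k F = adams k F := by
  rw [psiHat, MvPowerSeries.map_id]
  rfl

/-- Multiplication of indices by `k`, as an embedding. -/
def mulEmb (k : ℕ+) : ℕ+ ↪ ℕ+ := ⟨fun j => k * j, mul_right_injective k⟩

theorem coeff_adams_embDomain (k : ℕ+) (F : SymHat ℚ) (e : ℕ+ →₀ ℕ) :
    MvPowerSeries.coeff (Finsupp.embDomain (mulEmb k) e) (adams k F) = MvPowerSeries.coeff e F :=
  MvPowerSeries.coeff_embDomain_rename (mulEmb k) F e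

theorem coeff_adams_eq_zero (k : ℕ+) (F : SymHat ℚ) {e : ℕ+ →₀ ℕ}
    (h : ∀ d, e ≠ Finsupp.embDomain (mulEmb k) d) : MvPowerSeries.coeff e (adams k F) = 0 := by
  refine MvPowerSeries.coeff_rename_eq_zero _ F ?_
  rintro ⟨d, rfl⟩
  exact h d (Finsupp.embDomain_eq_mapDomain (mulEmb k) d).symm

theorem wt_embDomain (k : ℕ+) (e : ℕ+ →₀ ℕ) :
    wt (Finsupp.embDomain (mulEmb k) e) = k * wt e := by
  rw [wt_apply, wt_apply, Finsupp.sum_embDomain, Finsupp.mul_sum]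
  refine Finsupp.sum_congr fun j _ => ?_
  simp only [mulEmb, Function.Embedding.coeFn_mk, PNat.mul_coe]
  ring

theorem ordGE_adams (k : ℕ+) {F : SymHat ℚ} (hF : MvPowerSeries.coeff 0 F = 0) :
    OrdGE (k : ℕ) (adams k F) := fun e he => by
  by_contra h0
  have h1 : ∃ d, e = Finsupp.embDomain (mulEmb k) d := by
    by_contra h; push Not at h; exact h0 (coeff_adams_eq_zero k F h)
  obtain ⟨d, rfl⟩ := h1
  rw [coeff_adams_embDomain] at h0
  rw [wt_embDomain] at he
  have hd : wt d = 0 := by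
    by_contra h
    have := Nat.le_mul_of_pos_right (k : ℕ) (Nat.pos_of_ne_zero h)
    omega
  rw [wt_eq_zero hd] at h0
  exact h0 hF

theorem coeff_lie (n : ℕ) (hn : 0 < n) (e : ℕ+ →₀ ℕ) : (n : ℚ) * (lie n).coeff e =
    ∑ d ∈ n.divisors, if e = Finsupp.single d.toPNat' (n / d) then
      ((ArithmeticFunction.moebius d : ℤ) : ℚ) else 0 := by
  classical
  have hn' : (n : ℚ) ≠ 0 := by exact_mod_cast hn.ne'
  rw [lie, MvPolynomial.coeff_smul, smul_eq_mul, ← mul_assoc, mul_one_div_cancel hn', one_mul,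
    MvPolynomial.coeff_sum]
  refine Finset.sum_congr rfl fun d _ => ?_
  rw [MvPolynomial.coeff_smul, p, MvPolynomial.coeff_X_pow, smul_eq_mul]
  simp only [eq_comm, mul_ite, mul_one, mul_zero]

theorem coeff_lieSeries (e : ℕ+ →₀ ℕ) (he : wt e ≠ 0) :
    MvPowerSeries.coeff e lieSeries = (lie (wt e)).coeff e := by
  change (∑ᶠ n, MvPowerSeries.coeff e ((lie (n + 1) : Sym) : SymHat ℚ)) = _
  rw [finsum_eq_single _ (wt e - 1)]
  · rw [Nat.sub_add_cancel (Nat.pos_of_ne_zero he), MvPolynomial.coeff_coe]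
  · intro n hn
    rw [MvPolynomial.coeff_coe]
    have h := coeff_lie (n + 1) n.succ_pos e
    rw [Finset.sum_eq_zero] at h
    · exact (mul_eq_zero.1 h).resolve_left (by positivity)
    · intro d hd
      rw [if_neg]
      rintro rfl
      have hd' := Nat.pos_of_mem_divisors hd
      rw [wt_single, Nat.toPNat'_coe, if_pos hd', Nat.div_mul_cancel (Nat.dvd_of_mem_divisors hd)] at hn
      exact hn rfl

/-- The degree derivation clears the factor `1/n` of `ℓ_n`. With `euler_lieSeries_eq_zero` this says
`euler ℓ = ∑_d μ(d) ∑_{j ≥ 1} p_d^j`. -/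
theorem euler_lieSeries_single (d : ℕ+) (j : ℕ) :
    MvPowerSeries.coeff (Finsupp.single d (j + 1)) (euler lieSeries) =
      (ArithmeticFunction.moebius (d : ℕ) : ℤ) := by
  have hw : wt (Finsupp.single d (j + 1)) = (j + 1) * d := wt_single _ _
  have hpos : 0 < (j + 1) * (d : ℕ) := Nat.mul_pos j.succ_pos d.pos
  rw [coeff_euler, coeff_lieSeries _ (by rw [hw]; exact hpos.ne'), hw, coeff_lie _ hpos,
    Finset.sum_eq_single (d : ℕ)]
  · rw [Nat.mul_div_cancel _ d.pos, if_pos]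
    simp
  · intro b hb hbd
    rw [if_neg]
    intro h
    have h1 := (Finsupp.single_eq_single_iff _ _ _ _).1 h
    rcases h1 with ⟨h1, -⟩ | ⟨h1, -⟩
    · apply hbd
      rw [h1, Nat.toPNat'_coe, if_pos (Nat.pos_of_mem_divisors hb)]
    · exact absurd h1 (Nat.succ_ne_zero j)
  · intro h
    exact absurd (Nat.mem_divisors.2 ⟨Dvd.intro_left _ rfl, hpos.ne'⟩) h

theorem euler_lieSeries_eq_zero {e : ℕ+ →₀ ℕ} (h : ∀ d j, e ≠ Finsupp.single d (j + 1)) :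
    MvPowerSeries.coeff e (euler lieSeries) = 0 := by
  by_cases he : wt e = 0
  · rw [coeff_euler, he, Nat.cast_zero, zero_mul]
  · rw [coeff_euler, coeff_lieSeries _ he, coeff_lie _ (Nat.pos_of_ne_zero he), Finset.sum_eq_zero]
    intro d hd
    rw [if_neg]
    intro h1
    have h2 : 0 < wt e / d := Nat.div_pos (Nat.divisor_le hd) (Nat.pos_of_mem_divisors hd)
    obtain ⟨j, hj⟩ := Nat.exists_eq_succ_of_ne_zero h2.ne'
    rw [hj] at h1
    exact h _ _ h1

theorem coeff_zero_lieSeries : MvPowerSeries.coeff 0 lieSeries = 0 := by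
  change (∑ᶠ n, MvPowerSeries.coeff 0 ((lie (n + 1) : Sym) : SymHat ℚ)) = _
  rw [finsum_eq_zero_of_forall_eq_zero]
  intro n
  rw [MvPolynomial.coeff_coe]
  have h := coeff_lie (n + 1) n.succ_pos 0
  rw [Finset.sum_eq_zero] at h
  · exact (mul_eq_zero.1 h).resolve_left (by positivity)
  · intro d hd
    rw [if_neg]
    intro h1
    have h2 : 0 < (n + 1) / d := Nat.div_pos (Nat.divisor_le hd) (Nat.pos_of_mem_divisors hd)
    have := DFunLike.congr_fun h1 d.toPNat'
    rw [Finsupp.single_eq_same, Finsupp.zero_apply] at this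
    omega

/-- `ψ^k` multiplies degrees by `k`; this factor later cancels the `1/k` in the exponential. -/
theorem euler_adams (k : ℕ+) (F : SymHat ℚ) :
    euler (adams k F) = ((k : ℕ) : ℚ) • adams k (euler F) := by
  ext e
  rw [coeff_euler, map_smul, smul_eq_mul]
  by_cases h : ∃ d, e = Finsupp.embDomain (mulEmb k) d
  · obtain ⟨d, rfl⟩ := h
    rw [coeff_adams_embDomain, coeff_adams_embDomain, coeff_euler, wt_embDomain]
    push_cast
    ring
  · push Not at h
    rw [coeff_adams_eq_zero _ _ h, coeff_adams_eq_zero _ _ h, mul_zero, mul_zero]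

theorem coeff_adams_euler_lieSeries_single (k N : ℕ+) (j : ℕ) :
    MvPowerSeries.coeff (Finsupp.single N (j + 1)) (adams k (euler lieSeries)) =
      if (k : ℕ) ∣ N then ((ArithmeticFunction.moebius ((N : ℕ) / k) : ℤ) : ℚ) else 0 := by
  split_ifs with h
  · obtain ⟨d, rfl⟩ := PNat.dvd_iff.2 h
    have : Finsupp.single (k * d) (j + 1) =
        Finsupp.embDomain (mulEmb k) (Finsupp.single d (j + 1)) := by
      rw [Finsupp.embDomain_single]; rfl
    rw [this, coeff_adams_embDomain, euler_lieSeries_single, PNat.mul_coe,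
      Nat.mul_div_cancel_left _ k.pos]
  · refine coeff_adams_eq_zero _ _ fun d hd => h ?_
    have h1 : N ∈ (Finsupp.embDomain (mulEmb k) d).support := by
      rw [← hd]; simp
    rw [Finsupp.support_embDomain, Finset.mem_map] at h1
    obtain ⟨i, -, rfl⟩ := h1
    exact PNat.dvd_iff.1 (Dvd.intro i rfl)

theorem coeff_adams_euler_lieSeries_eq_zero (k : ℕ+) {e : ℕ+ →₀ ℕ}
    (h : ∀ d j, e ≠ Finsupp.single d (j + 1)) :
    MvPowerSeries.coeff e (adams k (euler lieSeries)) = 0 := by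
  by_cases h1 : ∃ d, e = Finsupp.embDomain (mulEmb k) d
  · obtain ⟨d, rfl⟩ := h1
    rw [coeff_adams_embDomain, euler_lieSeries_eq_zero]
    rintro i j rfl
    exact h _ _ (Finsupp.embDomain_single ..)
  · push Not at h1
    exact coeff_adams_eq_zero _ _ h1

/-! ## The series `λ_{-1}[ℓ(X) Y]` -/

/-- Plethysm with the Lie series. -/
noncomputable def lieAlg : Sym →ₐ[ℚ] SymHat ℚ := MvPolynomial.aeval fun k => adams k lieSeries

theorem lieAlg_X (k : ℕ+) : lieAlg (MvPolynomial.X k) = adams k lieSeries := by simp [lieAlg]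

theorem plethHat_lieSeries (f : Sym) : plethHat f lieSeries = lieAlg f := by
  simp only [plethHat, pleth, psiHat_id, lieAlg]

theorem ordGE_adams_lieSeries (k : ℕ+) : OrdGE (k : ℕ) (adams k lieSeries) :=
  ordGE_adams k coeff_zero_lieSeries

/-- Makes `λ_{-1}[ℓ(X)Y]` locally finite: a given monomial in `X` meets only finitely many `p_m(Y)`.
-/
theorem ordGE_lieAlg_monomial (m : ℕ+ →₀ ℕ) : OrdGE (wt m) (lieAlg (MvPolynomial.monomial m 1)) := by
  induction m using Finsupp.induction_linear with
  | zero => intro e he; simp at he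
  | add a b ha hb =>
    rw [map_add, show MvPolynomial.monomial (a + b) (1 : ℚ) = MvPolynomial.monomial a 1 *
      MvPolynomial.monomial b 1 by rw [MvPolynomial.monomial_mul, one_mul], map_mul]
    exact ha.mul hb
  | single k n =>
    rw [← MvPolynomial.X_pow_eq_monomial, map_pow, lieAlg_X, wt_single]
    exact (ordGE_adams_lieSeries k).pow n

/-- The series `λ_{-1}[ℓ(X) Y]`. -/
noncomputable def lieLambda : SymHat Sym := lambdaNegOne (inX lieSeries * inY (p 1))

theorem psiHat_inX_mul_inY (k : ℕ+) : psiHat (psi k : Sym →+* Sym) k (inX lieSeries * inY (p 1)) =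
    inX (adams k lieSeries) * MvPowerSeries.C (MvPolynomial.X k) := by
  rw [psiHat, map_mul, map_mul, inX, inY, MvPowerSeries.rename_map, MvPowerSeries.rename_C,
    MvPowerSeries.map_C]
  congr 1
  · ext1 e
    simp only [MvPowerSeries.coeff_map, inX, adams]
    exact MvPolynomial.rename_C _ _
  · congr 1
    simp only [psi, p, RingHom.coe_coe, MvPolynomial.rename_X]
    exact congrArg MvPolynomial.X (mul_one k)

/-- Since `p_k[ℓ(X)Y] = p_k[ℓ(X)] p_k(Y)`, the product `p_m(Y)` marks the monomial `p_m` of `f`. -/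
theorem coeff_plethXY (f : Sym) (e m : ℕ+ →₀ ℕ) :
    (MvPowerSeries.coeff e (plethXY f (inX lieSeries * inY (p 1)))).coeff m =
      f.coeff m * MvPowerSeries.coeff e (lieAlg (MvPolynomial.monomial m 1)) := by
  classical
  simp only [plethXY, pleth, psiHat_inX_mul_inY]
  induction f using MvPolynomial.induction_on' with
  | monomial d c =>
    have h : MvPolynomial.aeval (fun k : ℕ+ => inX (adams k lieSeries) *
        MvPowerSeries.C (MvPolynomial.X k : Sym)) (MvPolynomial.monomial d c) =
        inX (lieAlg (MvPolynomial.monomial d c)) *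
          MvPowerSeries.C (MvPolynomial.monomial d 1) := by
      rw [MvPolynomial.aeval_monomial, lieAlg, MvPolynomial.aeval_monomial]
      simp only [inX, map_mul, map_finsuppProd, map_pow, mul_pow, Finsupp.prod_mul,
        MvPolynomial.monomial_eq, one_mul, map_one]
      rw [mul_assoc]
      congr 1
    rw [h, MvPowerSeries.coeff_mul_C, inX, MvPowerSeries.coeff_map, MvPolynomial.coeff_C_mul,
      MvPolynomial.coeff_monomial, MvPolynomial.coeff_monomial]
    split_ifs with hd
    · subst hd
      rw [mul_one, ← MvPowerSeries.coeff_smul, ← map_smul, MvPolynomial.smul_monomial, smul_eq_mul,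
        mul_one]
    · simp
  | add f g hf hg => simp only [map_add, MvPolynomial.coeff_add, hf, hg, add_mul]

/-- The sign `(-1)^r` cancels the degree part of the sign in `e_r`, leaving the kernel `∑_m
(-1)^{length m} p_m[ℓ(X)] p_m(Y) / z_m`. -/
theorem coeff_lieLambda (e m : ℕ+ →₀ ℕ) :
    (MvPowerSeries.coeff e lieLambda).coeff m =
      (-1) ^ m.degree / zee m * MvPowerSeries.coeff e (lieAlg (MvPolynomial.monomial m 1)) := by
  have h : MvPowerSeries.coeff e lieLambda = ∑ᶠ r, MvPowerSeries.coeff e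
      ((-1) ^ r * plethXY (elementary r) (inX lieSeries * inY (p 1))) := rfl
  have hc (r : ℕ) (m : ℕ+ →₀ ℕ) : (MvPowerSeries.coeff e
      ((-1) ^ r * plethXY (elementary r) (inX lieSeries * inY (p 1)))).coeff m =
      if wt m = r then (-1) ^ m.degree / zee m *
        MvPowerSeries.coeff e (lieAlg (MvPolynomial.monomial m 1)) else 0 := by
    have h1 : ((-1) ^ r : SymHat Sym) = MvPowerSeries.C (MvPolynomial.C ((-1) ^ r)) := by simp
    rw [h1, MvPowerSeries.coeff_C_mul, MvPolynomial.coeff_C_mul, coeff_plethXY, coeff_elementary]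
    split_ifs with hr
    · rw [pow_add, ← mul_assoc, ← mul_div_assoc, ← mul_assoc, ← mul_pow]
      simp
    · simp
  have hfin : Function.support (fun r => MvPowerSeries.coeff e
      ((-1) ^ r * plethXY (elementary r) (inX lieSeries * inY (p 1)))) ⊆
      ((Finset.range (wt e + 1) : Finset ℕ) : Set ℕ) := by
    intro r hr
    by_contra h0
    refine hr ?_
    ext m
    simp only [hc]
    split_ifs with h1
    · rw [ordGE_lieAlg_monomial m e (by simp at h0; omega), mul_zero]
      simp
    · simp
  rw [h, finsum_eq_sum_of_support_subset _ hfin, MvPolynomial.coeff_sum]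
  simp only [hc]
  rw [Finset.sum_ite_eq]
  split_ifs with h1
  · rfl
  · rw [ordGE_lieAlg_monomial m e (by simp at h1; omega), mul_zero]

/-- Reproducing property of the kernel: pairing in `Y` cancels `1 / z_m`, and the sign left over is
that of the antipode. -/
theorem hall_coeff_lieLambda (f : Sym) (e : ℕ+ →₀ ℕ) :
    hall (R := ℚ) f ((MvPowerSeries.coeff e lieLambda : Sym) : SymHat ℚ) =
      MvPowerSeries.coeff e (lieAlg (antip f)) := by
  induction f using MvPolynomial.induction_on' with
  | monomial d c =>
    rw [hall_monomial, MvPolynomial.coeff_coe, coeff_lieLambda, antip_monomial,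
      ← mul_one ((-1) ^ d.degree * c), ← smul_eq_mul _ (1 : ℚ), ← MvPolynomial.smul_monomial,
      map_smul, MvPowerSeries.coeff_smul, smul_eq_mul]
    have := zee_ne_zero d
    field_simp
  | add f g hf hg => rw [hall_add_left, hf, hg, map_add, map_add, map_add]

/-- The truncation of `exp (-∑ p_k / k)` at degree `n`. -/
noncomputable def expTrunc (n : ℕ) : Sym :=
  ∑ m ∈ wtLe n, MvPolynomial.monomial m ((-1) ^ m.degree / zee m)

theorem coeff_expTrunc (n : ℕ) (e : ℕ+ →₀ ℕ) :
    (expTrunc n).coeff e = if wt e ≤ n then (-1) ^ e.degree / zee e else 0 := by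
  classical
  simp only [expTrunc, MvPolynomial.coeff_sum, MvPolynomial.coeff_monomial]
  rw [Finset.sum_ite_eq']
  simp

theorem pderiv_expTrunc {n i : ℕ} (hi : i < n) :
    MvPolynomial.pderiv i.succPNat (expTrunc n) =
      (-1 / ((i : ℚ) + 1)) • expTrunc (n - (i + 1)) := by
  ext e
  rw [MvPolynomial.coeff_pderiv, MvPolynomial.coeff_smul, coeff_expTrunc, coeff_expTrunc, map_add,
    wt_single, zee_add_single, map_add, Finsupp.degree_single, Nat.succPNat_coe, one_mul]
  by_cases h : wt e ≤ n - (i + 1)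
  · rw [if_pos h, if_pos (by omega), pow_succ, smul_eq_mul]
    have h1 := zee_ne_zero e
    have h2 : (i : ℚ) + 1 ≠ 0 := by positivity
    have h3 : (e i.succPNat : ℚ) + 1 ≠ 0 := by positivity
    push_cast
    field_simp
  · rw [if_neg h, if_neg (by omega)]
    simp

section Evaluation

variable (φ : Sym →ₐ[ℚ] ℚ)

/-- The value of `λ_{-1}[ℓ(X) Y]` at a specialization of the alphabet `Y`. -/
noncomputable def evalLambda : SymHat ℚ := fun e => φ (MvPowerSeries.coeff e lieLambda)

theorem coeff_evalLambda (e : ℕ+ →₀ ℕ) :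
    MvPowerSeries.coeff e (evalLambda φ) = φ (MvPowerSeries.coeff e lieLambda) := rfl

/-- Plethysm with `ℓ(X) Y`, with `Y` specialized. -/
noncomputable def evalLie : Sym →ₐ[ℚ] SymHat ℚ :=
  MvPolynomial.aeval fun k => φ (MvPolynomial.X k) • adams k lieSeries

theorem evalLie_X (k : ℕ+) :
    evalLie φ (MvPolynomial.X k) = φ (MvPolynomial.X k) • adams k lieSeries := by
  simp [evalLie]

theorem evalLie_monomial (m : ℕ+ →₀ ℕ) (c : ℚ) : evalLie φ (MvPolynomial.monomial m c) =
    φ (MvPolynomial.monomial m c) • lieAlg (MvPolynomial.monomial m 1) := by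
  have h (c : ℚ) (m : ℕ+ →₀ ℕ) :
      MvPolynomial.monomial m c = c • MvPolynomial.monomial m (1 : ℚ) := by
    rw [MvPolynomial.smul_monomial, smul_eq_mul, mul_one]
  rw [h, map_smul, map_smul, smul_assoc]
  congr 1
  induction m using Finsupp.induction_linear with
  | zero =>
    rw [show MvPolynomial.monomial (0 : ℕ+ →₀ ℕ) (1 : ℚ) = 1 from rfl, map_one, map_one, map_one,
      one_smul]
  | add a b ha hb =>
    rw [show MvPolynomial.monomial (a + b) (1 : ℚ) = MvPolynomial.monomial a 1 *
      MvPolynomial.monomial b 1 by rw [MvPolynomial.monomial_mul, one_mul], map_mul, map_mul,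
      map_mul, ha, hb, smul_mul_smul_comm]
  | single k n =>
    rw [← MvPolynomial.X_pow_eq_monomial, map_pow, map_pow, map_pow, lieAlg_X, evalLie_X, smul_pow]

/-- Plethysm applies to polynomials, so the exponential is truncated; an omitted `p_m` has degree
above `n`, and so has everything in `p_m[ℓ]`. -/
theorem evalLambda_eqUpTo {e : ℕ+ →₀ ℕ} {n : ℕ} (he : wt e ≤ n) :
    MvPowerSeries.coeff e (evalLambda φ) = MvPowerSeries.coeff e (evalLie φ (expTrunc n)) := by
  have h : MvPowerSeries.coeff e lieLambda = ∑ m ∈ wtLe n,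
      MvPolynomial.monomial m ((MvPowerSeries.coeff e lieLambda).coeff m) := by
    classical
    ext m
    rw [MvPolynomial.coeff_sum]
    simp only [MvPolynomial.coeff_monomial]
    rw [Finset.sum_ite_eq']
    split_ifs with hm
    · rfl
    · rw [coeff_lieLambda, ordGE_lieAlg_monomial m e (by simp at hm; omega), mul_zero]
  rw [coeff_evalLambda, h, expTrunc, map_sum, map_sum, map_sum]
  refine Finset.sum_congr rfl fun m _ => ?_
  rw [evalLie_monomial, coeff_lieLambda, MvPowerSeries.coeff_smul,
    mul_comm _ (MvPowerSeries.coeff e _), ← smul_eq_mul, ← MvPolynomial.smul_monomial, map_smul,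
    smul_eq_mul, mul_comm]

/-- The logarithmic derivative of `λ_{-1}[ℓ(X) Y]`, up to degree `n`. -/
theorem euler_evalLambda (n : ℕ) : EqUpTo n (euler (evalLambda φ))
    ((∑ i ∈ Finset.range n, -φ (MvPolynomial.X i.succPNat) •
      adams i.succPNat (euler lieSeries)) * evalLambda φ) := by
  have hord (k : ℕ+) : OrdGE (k : ℕ) (evalLie φ (MvPolynomial.X k)) := by
    rw [evalLie_X]
    exact (ordGE_adams_lieSeries k).smul _
  have h1 : EqUpTo n (evalLambda φ) (evalLie φ (expTrunc n)) := fun e he => evalLambda_eqUpTo φ he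
  intro e he
  rw [h1.euler e he, ← euler_algHom hord n _ e he, Finset.sum_mul]
  refine EqUpTo.sum (fun i hi => ?_) e he
  rw [Finset.mem_range] at hi
  have h2 : EqUpTo (n - (i + 1)) (evalLie φ (expTrunc (n - (i + 1)))) (evalLambda φ) :=
    fun e he => (evalLambda_eqUpTo φ he).symm
  -- Differentiation cost `i + 1` degrees of accuracy; the other factor starts in degree `i + 1` and
  -- restores them.
  have h3 := EqUpTo.mul_ordGE (k := i + 1) h2 (hord i.succPNat).euler
  rw [pderiv_expTrunc hi, map_smul, smul_mul_assoc]
  intro e he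
  rw [MvPowerSeries.coeff_smul, h3 e he, evalLie_X, map_smul, euler_adams, mul_smul_comm,
    mul_smul_comm, smul_mul_assoc, MvPowerSeries.coeff_smul, MvPowerSeries.coeff_smul,
    MvPowerSeries.coeff_smul, mul_comm (evalLambda φ), Nat.succPNat_coe]
  have h4 : (i : ℚ) + 1 ≠ 0 := by positivity
  push_cast
  field_simp

end Evaluation

/-! ## The product formula -/

/-- The series `-∑_N N c_N ∑_{j ≥ 1} p_N ^ j`. -/
noncomputable def logDer (c : ℕ+ →₀ ℕ) : SymHat ℚ := fun e =>
  if e.support.card = 1 then -∑ N ∈ e.support, ((N : ℕ) : ℚ) * c N else 0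

theorem coeff_logDer_single (c : ℕ+ →₀ ℕ) (N : ℕ+) (j : ℕ) :
    MvPowerSeries.coeff (Finsupp.single N (j + 1)) (logDer c) = -(((N : ℕ) : ℚ) * c N) := by
  have h : (Finsupp.single N (j + 1)).support = {N} := by
    ext i
    simp only [Finsupp.mem_support_iff, Finsupp.single_apply, Finset.mem_singleton]
    split_ifs with h <;> simp [h, eq_comm]
  change (if _ then _ else _) = _
  rw [h]
  simp

theorem coeff_logDer_eq_zero (c : ℕ+ →₀ ℕ) {e : ℕ+ →₀ ℕ} (h : ∀ d j, e ≠ Finsupp.single d (j + 1)) :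
    MvPowerSeries.coeff e (logDer c) = 0 := by
  refine if_neg fun h1 => ?_
  obtain ⟨d, b, hb, hd⟩ := Finsupp.card_support_eq_one'.1 h1
  obtain ⟨j, rfl⟩ := Nat.exists_eq_succ_of_ne_zero hb
  exact h d j hd

theorem coeff_zero_logDer (c : ℕ+ →₀ ℕ) : MvPowerSeries.coeff 0 (logDer c) = 0 := by
  refine coeff_logDer_eq_zero _ fun d j h => ?_
  have := DFunLike.congr_fun h d
  simp at this

theorem logDer_zero : logDer 0 = 0 := by
  ext e
  by_cases h : ∃ d j, e = Finsupp.single d (j + 1)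
  · obtain ⟨d, j, rfl⟩ := h
    rw [coeff_logDer_single]
    simp
  · push Not at h
    rw [coeff_logDer_eq_zero _ h, map_zero]

theorem logDer_add (c c' : ℕ+ →₀ ℕ) : logDer (c + c') = logDer c + logDer c' := by
  ext e
  rw [map_add]
  by_cases h : ∃ d j, e = Finsupp.single d (j + 1)
  · obtain ⟨d, j, rfl⟩ := h
    simp only [coeff_logDer_single, Finsupp.add_apply]
    push_cast
    ring
  · push Not at h
    simp only [coeff_logDer_eq_zero _ h, add_zero]

/-- The product `∏_N (1 - p_N) ^ c_N`. -/
noncomputable def prodOneSub (c : ℕ+ →₀ ℕ) : Sym := antip (transl 1 (MvPolynomial.monomial c 1))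

theorem prodOneSub_add (c c' : ℕ+ →₀ ℕ) : prodOneSub (c + c') = prodOneSub c * prodOneSub c' := by
  rw [prodOneSub, prodOneSub, prodOneSub, ← map_mul, ← map_mul, MvPolynomial.monomial_mul, one_mul]

theorem prodOneSub_zero : prodOneSub 0 = 1 := by
  rw [prodOneSub, show MvPolynomial.monomial (0 : ℕ+ →₀ ℕ) (1 : ℚ) = 1 from rfl, map_one, map_one]

theorem prodOneSub_single (N : ℕ+) :
    prodOneSub (Finsupp.single N 1) = 1 - MvPolynomial.X N := by
  rw [prodOneSub, ← MvPolynomial.X, transl_X, map_add, antip_X, MvPolynomial.C_1, map_one]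
  ring

/-- Up to sign this is `N p_N = (1 - p_N) ∑_{j ≥ 1} N p_N^j`. -/
theorem euler_one_sub_X (N : ℕ+) : euler ((1 - MvPolynomial.X N : Sym) : SymHat ℚ) =
    logDer (Finsupp.single N 1) * ((1 - MvPolynomial.X N : Sym) : SymHat ℚ) := by
  classical
  rw [coe_sub, MvPolynomial.coe_one, MvPolynomial.coe_X, map_sub, ← map_one MvPowerSeries.C, euler_C,
    euler_X, map_one, mul_sub, mul_one]
  ext e
  rw [map_sub, map_sub, map_zero, map_smul, MvPowerSeries.X, MvPowerSeries.coeff_mul_monomial,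
    ← MvPowerSeries.X, MvPowerSeries.coeff_X, zero_sub, smul_eq_mul, mul_one]
  by_cases h : ∃ d j, e = Finsupp.single d (j + 1)
  · obtain ⟨d, j, rfl⟩ := h
    by_cases hd : d = N
    · subst hd
      have hle : Finsupp.single d 1 ≤ Finsupp.single d (j + 1) := by
        rw [Finsupp.single_le_iff, Finsupp.single_eq_same]
        omega
      rw [if_pos hle, ← Finsupp.single_tsub, Nat.add_sub_cancel,
        coeff_logDer_single]
      cases j with
      | zero => rw [Finsupp.single_zero, coeff_zero_logDer]; simp
      | succ j =>
        rw [coeff_logDer_single, if_neg]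
        · simp
        · rw [Finsupp.single_eq_single_iff]; omega
    · rw [coeff_logDer_single, if_neg, if_neg]
      · simp [Finsupp.single_eq_of_ne hd]
      · simp [Finsupp.single_le_iff, Finsupp.single_eq_of_ne' hd]
      · rw [Finsupp.single_eq_single_iff]
        tauto
  · push Not at h
    rw [coeff_logDer_eq_zero _ h, if_neg (h N 0)]
    split_ifs with h1
    · by_cases h2 : ∃ d j, e - Finsupp.single N 1 = Finsupp.single d (j + 1)
      · obtain ⟨d, j, hd⟩ := h2
        rw [hd, coeff_logDer_single, Finsupp.single_eq_of_ne]
        · simp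
        · rintro rfl
          apply h d (j + 1)
          rw [← tsub_add_cancel_of_le h1, hd, ← Finsupp.single_add]
      · push Not at h2
        rw [coeff_logDer_eq_zero _ h2]
        simp
    · simp

theorem euler_prodOneSub (c : ℕ+ →₀ ℕ) :
    euler (prodOneSub c : Sym) = logDer c * ((prodOneSub c : Sym) : SymHat ℚ) := by
  have hadd (a b : ℕ+ →₀ ℕ)
      (ha : euler (prodOneSub a : Sym) = logDer a * ((prodOneSub a : Sym) : SymHat ℚ))
      (hb : euler (prodOneSub b : Sym) = logDer b * ((prodOneSub b : Sym) : SymHat ℚ)) :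
      euler (prodOneSub (a + b) : Sym) =
        logDer (a + b) * ((prodOneSub (a + b) : Sym) : SymHat ℚ) := by
    rw [prodOneSub_add, MvPolynomial.coe_mul, euler_mul, ha, hb, logDer_add]
    ring
  have hzero : euler (prodOneSub 0 : Sym) = logDer 0 * ((prodOneSub 0 : Sym) : SymHat ℚ) := by
    rw [prodOneSub_zero, MvPolynomial.coe_one, ← map_one MvPowerSeries.C, euler_C, map_one, mul_one]
    exact logDer_zero.symm
  induction c using Finsupp.induction_linear with
  | zero => exact hzero
  | add a b ha hb => exact hadd a b ha hb
  | single N n =>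
    induction n with
    | zero => rw [Finsupp.single_zero]; exact hzero
    | succ n ih =>
      rw [Finsupp.single_add]
      refine hadd _ _ ih ?_
      rw [prodOneSub_single, euler_one_sub_X]

/-- Both sides have constant term `1` and the same logarithmic derivative: on the left its
coefficient at `p_N^j` is `-∑_{k ∣ N} μ(N/k) φ(p_k)`, which Möbius inversion of `hφ` identifies with
`-N c_N`. -/
theorem evalLambda_eq {φ : Sym →ₐ[ℚ] ℚ} {c : ℕ+ →₀ ℕ} (hφ : ∀ k : ℕ+, φ (MvPolynomial.X k) =
    ∑ d ∈ (k : ℕ).divisors, ((d : ℕ) : ℚ) * c d.toPNat') :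
    evalLambda φ = (prodOneSub c : Sym) := by
  classical
  let y : ℕ → ℚ := fun k => φ (MvPolynomial.X k.toPNat')
  have hy (k : ℕ+) : y k = φ (MvPolynomial.X k) := by simp [y]
  have hmoeb := (ArithmeticFunction.sum_eq_iff_sum_mul_moebius_eq
    (f := fun d : ℕ => (d : ℚ) * c d.toPNat') (g := y)).1 (fun n hn => by
      obtain ⟨k, rfl⟩ : ∃ k : ℕ+, (k : ℕ) = n := ⟨⟨n, hn⟩, rfl⟩
      rw [hy, hφ])
  have hA (n : ℕ) : EqUpTo n (∑ i ∈ Finset.range n, -φ (MvPolynomial.X i.succPNat) •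
      adams i.succPNat (euler lieSeries)) (logDer c) := by
    intro e he
    by_cases h : ∃ d j, e = Finsupp.single d (j + 1)
    · obtain ⟨N, j, rfl⟩ := h
      have hN : (N : ℕ) ≤ n := by
        rw [wt_single] at he
        exact (Nat.le_mul_of_pos_left _ j.succ_pos).trans he
      have h1 := hmoeb N N.pos
      simp only [PNat.coe_toPNat'] at h1
      rw [coeff_logDer_single, ← h1, map_sum, Nat.sum_divisorsAntidiagonal'
        (f := fun a b => ((ArithmeticFunction.moebius a : ℤ) : ℚ) * y b), ← Finset.sum_neg_distrib]
      have hterm (i : ℕ) : MvPowerSeries.coeff (Finsupp.single N (j + 1))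
          (-φ (MvPolynomial.X i.succPNat) • adams i.succPNat (euler lieSeries)) =
          if (i + 1) ∣ (N : ℕ) then -φ (MvPolynomial.X i.succPNat) *
            (ArithmeticFunction.moebius ((N : ℕ) / (i + 1)) : ℤ) else 0 := by
        rw [MvPowerSeries.coeff_smul, coeff_adams_euler_lieSeries_single]
        have h2 : ((i.succPNat : ℕ+) : ℕ) = i + 1 := rfl
        split_ifs with h3 h4 h4
        · rw [h2]
        · exact absurd h3 h4
        · exact absurd h4 h3
        · rw [mul_zero]
      simp only [hterm]
      rw [← Finset.sum_filter]
      refine Finset.sum_nbij' Nat.succ Nat.pred ?_ ?_ ?_ ?_ ?_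
      · intro i hi
        exact Nat.mem_divisors.2 ⟨(Finset.mem_filter.1 hi).2, N.ne_zero⟩
      · intro d hd
        have h3 := Nat.pos_of_mem_divisors hd
        have h4 := Nat.divisor_le hd
        refine Finset.mem_filter.2 ⟨Finset.mem_range.2 (by rw [Nat.pred_eq_sub_one]; omega), ?_⟩
        have h5 : d.pred + 1 = d := Nat.succ_pred_eq_of_pos h3
        rw [h5]
        exact Nat.dvd_of_mem_divisors hd
      · intro i _; rfl
      · intro d hd
        exact Nat.succ_pred_eq_of_pos (Nat.pos_of_mem_divisors hd)
      · intro i _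
        rw [show y i.succ = φ (MvPolynomial.X i.succPNat) from rfl]
        ring
    · push Not at h
      rw [coeff_logDer_eq_zero _ h, map_sum, Finset.sum_eq_zero]
      intro i _
      rw [MvPowerSeries.coeff_smul, coeff_adams_euler_lieSeries_eq_zero _ h, mul_zero]
  refine eq_of_euler_eq (coeff_zero_logDer c) ?_ (euler_prodOneSub c) ?_
  · ext e
    exact (euler_evalLambda φ (wt e) e le_rfl).trans
      ((hA (wt e)).mul (EqUpTo.refl _ _) e le_rfl)
  · have h1 : expTrunc 0 = 1 := by
      ext e
      rw [coeff_expTrunc, MvPolynomial.coeff_one]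
      by_cases he : e = 0
      · subst he; simp
      · rw [if_neg fun h => he (wt_eq_zero (Nat.le_zero.1 h)), if_neg (Ne.symm he)]
    rw [evalLambda_eqUpTo φ (n := 0) (by simp), h1, map_one, MvPolynomial.coeff_coe, prodOneSub,
      coeff_antip, ← MvPolynomial.constantCoeff_eq, transl, MvPolynomial.aeval_monomial]
    simp [Finsupp.prod]

/-! ## Power sums of the eigenvalues -/

/-- Both sides are multiplicative in `q`, which splits; for a linear factor `X - a` this is the
characteristic polynomial at `a`, up to `(-1)^n`. -/
theorem det_aeval {K : Type*} [Field K] [IsAlgClosed K] {n : ℕ} (A : Matrix (Fin n) (Fin n) K)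
    (q : Polynomial K) : (Polynomial.aeval A q).det = (A.charpoly.roots.map q.eval).prod := by
  have hcard : A.charpoly.roots.card = n := by
    rw [← (IsAlgClosed.splits A.charpoly).natDegree_eq_card_roots, Matrix.charpoly_natDegree_eq_dim,
      Fintype.card_fin]
  have hX (a : K) : (Polynomial.aeval A (Polynomial.X - Polynomial.C a)).det =
      (A.charpoly.roots.map (Polynomial.X - Polynomial.C a).eval).prod := by
    have h1 := (IsAlgClosed.splits A.charpoly).eval_eq_prod_roots_of_monic A.charpoly_monic a
    rw [Matrix.eval_charpoly] at h1
    have h2 : Polynomial.aeval A (Polynomial.X - Polynomial.C a) = -(Matrix.scalar (Fin n) a - A) := by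
      rw [map_sub, Polynomial.aeval_X, Polynomial.aeval_C, neg_sub]
      rfl
    have h3 := Multiset.prod_map_neg (A.charpoly.roots.map (a - ·))
    rw [Multiset.card_map, hcard, Multiset.map_map] at h3
    rw [h2, Matrix.det_neg, h1, Fintype.card_fin, ← h3]
    simp
  have key (s : Multiset K) (l : K) : (Polynomial.aeval A (Polynomial.C l *
      (s.map fun a => Polynomial.X - Polynomial.C a).prod)).det = (A.charpoly.roots.map
      (Polynomial.C l * (s.map fun a => Polynomial.X - Polynomial.C a).prod).eval).prod := by
    induction s using Multiset.induction_on with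
    | empty =>
      simp only [Multiset.map_zero, Multiset.prod_zero, mul_one, Polynomial.aeval_C]
      rw [Matrix.algebraMap_eq_diagonal, Matrix.det_diagonal]
      simp [hcard]
    | cons a s ih =>
      rw [Multiset.map_cons, Multiset.prod_cons, mul_left_comm, map_mul, Matrix.det_mul, ih, hX,
        ← Multiset.prod_map_mul]
      simp only [Polynomial.eval_mul]
  have hs := IsAlgClosed.splits q
  rw [hs.eq_prod_roots]
  exact key _ _

/-- Taking `q = c - X^k` in `det_aeval` shows that the eigenvalues of `A^k` are the `ω^k` with
multiplicity. -/
theorem sum_roots_charpoly_pow {K : Type*} [Field K] [IsAlgClosed K] {n : ℕ}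
    (A : Matrix (Fin n) (Fin n) K) (k : ℕ) :
    (A.charpoly.roots.map fun ω => ω ^ k).sum = (A ^ k).trace := by
  have h : (A ^ k).charpoly = ((A.charpoly.roots.map fun ω => ω ^ k).map
      fun a => Polynomial.X - Polynomial.C a).prod := by
    refine Polynomial.funext fun c => ?_
    have h1 := det_aeval A (Polynomial.C c - Polynomial.X ^ k)
    rw [Polynomial.eval_multiset_prod, Multiset.map_map, Multiset.map_map, Matrix.eval_charpoly]
    convert! h1 using 2
    · rw [map_sub, map_pow, Polynomial.aeval_X, Polynomial.aeval_C]
      rfl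
    · refine congrArg₂ _ ?_ rfl
      funext ω
      simp
  rw [Matrix.trace_eq_sum_roots_charpoly, h, Polynomial.roots_multiset_prod_X_sub_C]

theorem permMatrix_pow {n : ℕ} (τ : Equiv.Perm (Fin n)) (k : ℕ) :
    τ.permMatrix ℂ ^ k = (τ ^ k).permMatrix ℂ := by
  induction k with
  | zero => simp
  | succ k ih => rw [pow_succ, ih, pow_succ', Matrix.permMatrix_mul]

theorem pow_apply_eq_self_iff {α : Type*} [Fintype α] [DecidableEq α] {τ c : Equiv.Perm α} {x : α}
    (hc : c ∈ τ.cycleFactorsFinset) (hx : x ∈ c.support) (k : ℕ) :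
    (τ ^ k) x = x ↔ c.support.card ∣ k := by
  have hcyc := (Equiv.Perm.mem_cycleFactorsFinset_iff.1 hc).1
  have h1 := (Equiv.Perm.eq_cycleOf_of_mem_cycleFactorsFinset_iff τ c hc x).2 hx
  rw [← Equiv.Perm.cycleOf_pow_apply_self, ← h1, ← hcyc.orderOf, orderOf_dvd_iff_pow_eq_one,
    hcyc.pow_eq_one_iff' (Equiv.Perm.mem_support.1 hx)]

theorem sum_divisors_count (s : Multiset ℕ) {k : ℕ} (hk : k ≠ 0) :
    ∑ d ∈ k.divisors, d * s.count d = (s.map fun i => if i ∣ k then i else 0).sum := by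
  induction s using Multiset.induction_on with
  | empty => simp
  | cons a s ih =>
    rw [Multiset.map_cons, Multiset.sum_cons, ← ih]
    simp only [Multiset.count_cons, mul_add, Finset.sum_add_distrib, mul_ite, mul_one, mul_zero]
    rw [Finset.sum_ite_eq', add_comm]
    simp [hk]

/-- `τ^k` fixes `x` exactly when the length of the cycle through `x` divides `k`, so a cycle of
length `d ∣ k` contributes its `d` points. -/
theorem card_fixed_pow {n : ℕ} (τ : Equiv.Perm (Fin n)) {k : ℕ} (hk : k ≠ 0) :
    (Finset.univ.filter fun x => (τ ^ k) x = x).card =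
      ∑ d ∈ k.divisors, d * τ.partition.parts.count d := by
  rw [sum_divisors_count _ hk, Equiv.Perm.parts_partition, Multiset.map_add, Multiset.sum_add,
    Multiset.map_replicate, Multiset.sum_replicate, if_pos (one_dvd k), smul_eq_mul, mul_one,
    Equiv.Perm.cycleType_def, Multiset.map_map, Finset.card_filter,
    ← Finset.sum_add_sum_compl τ.support, Finset.sum_congr (s₁ := τ.supportᶜ) rfl (g := fun _ => 1)]
  · rw [Finset.sum_const, smul_eq_mul, mul_one, Finset.card_compl]
    congr 1
    rw [← Finset.sum_fiberwise_of_maps_to (t := τ.cycleFactorsFinset) (g := τ.cycleOf)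
      fun x hx => Equiv.Perm.cycleOf_mem_cycleFactorsFinset_iff.2 hx]
    change _ = ∑ c ∈ τ.cycleFactorsFinset, if c.support.card ∣ k then c.support.card else 0
    refine Finset.sum_congr rfl fun c hc => ?_
    have h1 : (τ.support.filter fun x => τ.cycleOf x = c) = c.support := by
      ext x
      rw [Finset.mem_filter, ← Equiv.Perm.eq_cycleOf_of_mem_cycleFactorsFinset_iff τ c hc x,
        ← Equiv.Perm.cycleOf_mem_cycleFactorsFinset_iff]
      constructor
      · exact fun h => h.2.symm
      · rintro rfl; exact ⟨hc, rfl⟩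
    rw [h1, Finset.sum_congr rfl fun x hx => if_congr (pow_apply_eq_self_iff hc hx k) rfl rfl]
    split_ifs <;> simp
  · intro x hx
    rw [Finset.mem_compl, Equiv.Perm.notMem_support] at hx
    rw [if_pos]
    exact Function.IsFixedPt.perm_pow hx k

/-- The specialization `p_k ↦ ∑_{d ∣ k} d c_d`. -/
noncomputable def cycleEval (c : ℕ+ →₀ ℕ) : Sym →ₐ[ℚ] ℚ :=
  MvPolynomial.aeval fun k : ℕ+ => ∑ d ∈ (k : ℕ).divisors, ((d : ℕ) : ℚ) * c d.toPNat'

theorem cycleEval_X (c : ℕ+ →₀ ℕ) (k : ℕ+) : cycleEval c (MvPolynomial.X k) =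
    ∑ d ∈ (k : ℕ).divisors, ((d : ℕ) : ℚ) * c d.toPNat' := by
  simp [cycleEval]

theorem evalEigenvalues_eq (f : Sym) {n : ℕ} (τ : Equiv.Perm (Fin n)) :
    evalEigenvalues f τ = (cycleEval (expo τ.partition) f : ℚ) := by
  have h : evalEigenvalues f τ = (algebraMap ℚ ℂ) (cycleEval (expo τ.partition) f) := by
    rw [evalEigenvalues, cycleEval, ← MvPolynomial.aeval_algebraMap_apply]
    congr 2
    funext k
    rw [sum_roots_charpoly_pow, permMatrix_pow, Matrix.trace_permutation]
    have h1 : (Function.fixedPoints ⇑(τ ^ (k : ℕ))).ncard =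
        ∑ d ∈ (k : ℕ).divisors, d * τ.partition.parts.count d := by
      rw [← card_fixed_pow τ k.ne_zero, ← Set.ncard_coe_finset]
      congr 1
      ext x
      simp [Function.IsFixedPt]
    rw [h1, Function.comp_apply, map_sum]
    push_cast
    refine Finset.sum_congr rfl fun d hd => ?_
    rw [expo_apply, Nat.toPNat'_coe, if_pos (Nat.pos_of_mem_divisors hd)]
  exact h

theorem exists_perm_expo (e : ℕ+ →₀ ℕ) {n : ℕ} (he : wt e = n) :
    ∃ τ : Equiv.Perm (Fin n), expo τ.partition = e := by
  obtain ⟨μ, rfl⟩ := exists_expo e he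
  have hsplit := Multiset.filter_add_not (fun i => 2 ≤ i) μ.parts
  have hone : μ.parts.filter (fun i => ¬ 2 ≤ i) =
      Multiset.replicate (μ.parts.filter fun i => ¬ 2 ≤ i).card 1 := by
    rw [Multiset.eq_replicate_card]
    intro b hb
    rw [Multiset.mem_filter] at hb
    have := μ.parts_pos hb.1
    omega
  have hsum : (μ.parts.filter fun i => 2 ≤ i).sum + (μ.parts.filter fun i => ¬ 2 ≤ i).card = n := by
    have h1 := congrArg Multiset.sum hsplit
    rw [Multiset.sum_add, hone, Multiset.sum_replicate, μ.parts_sum, smul_eq_mul, mul_one] at h1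
    exact h1
  obtain ⟨τ, hτ⟩ := (Equiv.Perm.exists_with_cycleType_iff (Fin n)
    (m := μ.parts.filter fun i => 2 ≤ i)).2 ⟨by rw [Fintype.card_fin]; omega,
      fun a ha => (Multiset.mem_filter.1 ha).2⟩
  refine ⟨τ, ?_⟩
  rw [expo, expo, Equiv.Perm.parts_partition, hτ, ← Equiv.Perm.sum_cycleType, hτ, Fintype.card_fin]
  congr 2
  conv_rhs => rw [← hsplit, hone]
  congr 2
  omega

/-! ## Symmetric functions are determined by their values on permutations -/

/-- The substitution `p_k = ∑_{d ∣ k} d c_d` is invertible by Möbius inversion, so `f` may be read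
as a polynomial in the cycle counts, and it vanishes on an infinite grid. -/
theorem eq_zero_of_cycleEval {f : Sym} (B : ℕ) (h : ∀ c : ℕ+ →₀ ℕ, B ≤ c 1 → cycleEval c f = 0) :
    f = 0 := by
  let θ : Sym →ₐ[ℚ] Sym := MvPolynomial.aeval fun k : ℕ+ =>
    ∑ d ∈ (k : ℕ).divisors, ((d : ℕ) : ℚ) • MvPolynomial.X d.toPNat'
  let g : ℕ → Sym := fun d => ∑ x ∈ d.divisorsAntidiagonal,
    ((ArithmeticFunction.moebius x.1 : ℤ) : Sym) * MvPolynomial.X x.2.toPNat'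
  let ψ : Sym →ₐ[ℚ] Sym := MvPolynomial.aeval fun k : ℕ+ => (1 / ((k : ℕ) : ℚ)) • g k
  have hψθ (f : Sym) : ψ (θ f) = f := by
    change ψ.comp θ f = AlgHom.id ℚ _ f
    congr 1
    ext k : 1
    have h1 := (ArithmeticFunction.sum_eq_iff_sum_mul_moebius_eq (f := g)
      (g := fun d => (MvPolynomial.X d.toPNat' : Sym))).2 (fun n _ => rfl) k k.pos
    simp only [PNat.coe_toPNat'] at h1
    simp only [AlgHom.comp_apply, θ, MvPolynomial.aeval_X, map_sum, map_smul, AlgHom.id_apply]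
    rw [← h1]
    refine Finset.sum_congr rfl fun d hd => ?_
    have hd' := Nat.pos_of_mem_divisors hd
    have hd0 : (d : ℚ) ≠ 0 := by exact_mod_cast hd'.ne'
    simp only [ψ, MvPolynomial.aeval_X, Nat.toPNat'_coe, if_pos hd', smul_smul]
    rw [mul_one_div_cancel hd0, one_smul]
  have hθ : θ f = 0 := by
    refine MvPolynomial.funext_set (fun _ => {x : ℚ | ∃ m : ℕ, B ≤ m ∧ x = m}) (fun _ => ?_) ?_
    · refine Set.infinite_of_injective_forall_mem (f := fun m : ℕ => ((B + m : ℕ) : ℚ)) ?_ ?_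
      · intro a b hab
        simpa using hab
      · exact fun m => ⟨B + m, Nat.le_add_right _ _, rfl⟩
    · intro x hx
      choose m hm using fun i => hx i (Set.mem_univ i)
      classical
      -- Finite support is required, so only the variables of `θ f` are kept; the index `1` is added
      -- to secure `B ≤ c 1`.
      let c : ℕ+ →₀ ℕ := Finsupp.onFinset (insert 1 (θ f).vars)
        (fun i => if i ∈ insert 1 (θ f).vars then m i else 0) (by
          intro i hi
          by_contra h0
          simp [h0] at hi)
      have hc (i : ℕ+) (hi : i ∈ insert 1 (θ f).vars) : c i = m i := if_pos hi
      have h1 : MvPolynomial.eval x (θ f) = MvPolynomial.eval (fun i => (c i : ℚ)) (θ f) := by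
        refine MvPolynomial.eval₂Hom_congr' rfl (fun i hi _ => ?_) rfl
        rw [hc i (Finset.mem_insert_of_mem hi)]
        exact (hm i).2
      have h2 : MvPolynomial.eval (fun i => (c i : ℚ)) (θ f) = cycleEval c f := by
        change ((MvPolynomial.aeval fun i => (c i : ℚ)).comp θ) f = _
        congr 1
        ext k
        simp [θ, cycleEval]
      rw [h1, h2, map_zero]
      refine h c ?_
      rw [hc 1 (Finset.mem_insert_self _ _)]
      exact (hm 1).1
  rw [← hψθ f, hθ, map_zero]

/-! ## The stable characters -/

/-- The antipode and the shift move to the other argument, leaving a pairing with `p_c`. The result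
is the value at cycle type `c` of the class function with characteristic `σ₁ · antip f`. -/
theorem hall_prodOneSub (f : Sym) (c : ℕ+ →₀ ℕ) :
    hall (R := ℚ) f (prodOneSub c : Sym) =
      zee c * MvPowerSeries.coeff c (sig 1 * ((antip f : Sym) : SymHat ℚ)) := by
  rw [prodOneSub, ← antip_antip f, hall_antip_antip, hall_comm, ← hall_sig_mul, hall_monomial,
    one_mul, antip_antip]
  rfl

theorem cycleEval_hall (c : ℕ+ →₀ ℕ) (f : Sym) (F : SymHat ℚ) :
    cycleEval c (hall f (inX F * lieLambda)) = hall f (F * ((prodOneSub c : Sym) : SymHat ℚ)) := by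
  rw [← evalLambda_eq (cycleEval_X c)]
  have h := hall_map (cycleEval c).toLinearMap f (inX F * lieLambda)
  refine h.trans (hall_congr fun e _ => ?_)
  change cycleEval c (MvPowerSeries.coeff e (inX F * lieLambda)) = _
  rw [MvPowerSeries.coeff_mul, MvPowerSeries.coeff_mul, map_sum]
  refine Finset.sum_congr rfl fun x _ => ?_
  rw [map_mul, inX, MvPowerSeries.coeff_map, coeff_evalLambda]
  congr 1
  exact (cycleEval c).commutes _

/-- The two pairings commute, and pairing in `Y` first turns the kernel into `(antip g)[ℓ(X)]`. -/
theorem hall_hall (g f : Sym) (F : SymHat ℚ) :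
    hall (R := ℚ) g ((hall f (inX F * lieLambda) : Sym) : SymHat ℚ) =
      hall f (F * lieAlg (antip g)) := by
  have h := hall_map (hallForm g) f (inX F * lieLambda)
  refine h.trans (hall_congr fun e _ => ?_)
  change hallForm g (MvPowerSeries.coeff e (inX F * lieLambda)) = _
  rw [MvPowerSeries.coeff_mul, MvPowerSeries.coeff_mul, map_sum]
  refine Finset.sum_congr rfl fun x _ => ?_
  rw [← hall_coeff_lieLambda, inX, MvPowerSeries.coeff_map, ← MvPolynomial.smul_eq_C_mul, map_smul]
  rfl

/-- The right-hand side of the formula for the stable irreducible character. -/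
noncomputable def stableIrr (la : YoungDiagram) : Sym :=
  (-1) ^ la.card * hall (schur la.transpose) (inX sigmaOne * lieLambda)

/-- The right-hand side of the formula for the stable induced character. -/
noncomputable def stableInd (la : YoungDiagram) : Sym :=
  (-1) ^ la.card * hall (schur la.transpose) lieLambda

theorem neg_one_pow_mul_eq_smul (n : ℕ) (f : Sym) : (-1) ^ n * f = (-1 : ℚ) ^ n • f := by
  rw [MvPolynomial.smul_eq_C_mul, map_pow, map_neg, map_one]

theorem neg_one_pow_mul_self (n : ℕ) : (-1 : ℚ) ^ n * (-1) ^ n = 1 := by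
  rw [← mul_pow]; simp

/-- The factor `σ₁` shifts `s_{λ'}` to `s_{λ'}(X+1)`, whose antipode is `(-1)^{|λ|} s_λ(X-1)`; the
two signs cancel. -/
theorem cycleEval_stableIrr (la : YoungDiagram) (c : ℕ+ →₀ ℕ) : cycleEval c (stableIrr la) =
    zee c * MvPowerSeries.coeff c (sig 1 * ((transl (-1) (schur la) : Sym) : SymHat ℚ)) := by
  rw [stableIrr, neg_one_pow_mul_eq_smul, map_smul, cycleEval_hall, sigmaOne_eq, hall_sig_mul,
    hall_prodOneSub]
  have h : antip (transl 1 (schur la.transpose)) = (-1 : ℚ) ^ la.card • transl (-1) (schur la) := by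
    rw [← map_smul, ← antip_schur_transpose, transl_antip, neg_neg]
  rw [h, coe_smul', mul_smul_comm, MvPowerSeries.coeff_smul, smul_eq_mul]
  linear_combination (zee c * MvPowerSeries.coeff c
    (sig 1 * ((transl (-1) (schur la) : Sym) : SymHat ℚ))) * neg_one_pow_mul_self la.card

theorem cycleEval_stableInd (la : YoungDiagram) (c : ℕ+ →₀ ℕ) : cycleEval c (stableInd la) =
    zee c * MvPowerSeries.coeff c (sig 1 * ((schur la : Sym) : SymHat ℚ)) := by
  have h1 : lieLambda = inX 1 * lieLambda := by rw [inX, map_one, one_mul]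
  rw [stableInd, h1, neg_one_pow_mul_eq_smul, map_smul, cycleEval_hall, one_mul, hall_prodOneSub,
    antip_schur_transpose, coe_smul', mul_smul_comm, MvPowerSeries.coeff_smul, smul_eq_mul]
  linear_combination (zee c * MvPowerSeries.coeff c
    (sig 1 * ((schur la : Sym) : SymHat ℚ))) * neg_one_pow_mul_self la.card

theorem wt_expo_partition {n : ℕ} (τ : Equiv.Perm (Fin n)) : wt (expo τ.partition) = n := by
  rw [wt_expo, Fintype.card_fin]

theorem isStableIrreducible_stableIrr (la : YoungDiagram) : IsStableIrreducible la (stableIrr la) := by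
  intro m _ τ
  rw [evalEigenvalues_eq, cycleEval_stableIrr, irrChar, classValue, schurSeq_cons, schur,
    schurSeq_eq_jt, coeff_sig_mul_transl_jt _ (m := (m : ℤ))]
  rw [wt_expo_partition, ← sum_rowLens]
  simp only [List.get_eq_getElem, ← Nat.cast_sum, Fin.sum_univ_getElem]
  push_cast
  ring

theorem isStableInduced_stableInd (la : YoungDiagram) : IsStableInduced la (stableInd la) := by
  intro n τ
  rw [evalEigenvalues_eq, cycleEval_stableInd, classValue, sigmaOne_eq]

theorem eq_of_evalEigenvalues {f g : Sym} (k B : ℕ) (h : ∀ m, B ≤ m →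
    ∀ τ : Equiv.Perm (Fin (k + m)), evalEigenvalues f τ = evalEigenvalues g τ) : f = g := by
  -- At least `k + B` fixed points force the size of the permutation to be `k + m` with `m ≥ B`.
  refine sub_eq_zero.1 (eq_zero_of_cycleEval (k + B) fun c hc => ?_)
  have h1 := le_wt c 1
  rw [PNat.one_coe, mul_one] at h1
  obtain ⟨m, hm⟩ := Nat.exists_eq_add_of_le ((Nat.le_add_right k B).trans (hc.trans h1))
  obtain ⟨τ, rfl⟩ := exists_perm_expo c hm
  have h2 := h m (by omega) τ
  rw [evalEigenvalues_eq, evalEigenvalues_eq] at h2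
  rw [map_sub, sub_eq_zero]
  exact_mod_cast h2

theorem isStableIrreducible_iff {la : YoungDiagram} {f : Sym} :
    IsStableIrreducible la f ↔ f = stableIrr la := by
  refine ⟨fun h => eq_of_evalEigenvalues la.card (la.rowLen 0) fun m hm τ => ?_, ?_⟩
  · rw [h m hm τ, isStableIrreducible_stableIrr la m hm τ]
  · rintro rfl; exact isStableIrreducible_stableIrr la

theorem isStableInduced_iff {la : YoungDiagram} {f : Sym} :
    IsStableInduced la f ↔ f = stableInd la := by
  refine ⟨fun h => eq_of_evalEigenvalues 0 0 fun m _ τ => ?_, ?_⟩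
  · rw [h _ τ, isStableInduced_stableInd la _ τ]
  · rintro rfl; exact isStableInduced_stableInd la

theorem pleth_p_one_add_one (f : Sym) : pleth (fun k => psi k) f (p 1 + 1) = transl 1 f := by
  have h (k : ℕ+) : psi k (p 1 + 1) = MvPolynomial.X k + MvPolynomial.C 1 := by
    rw [map_add, map_one, MvPolynomial.C_1, psi, p, MvPolynomial.rename_X]
    exact congrArg (fun j => MvPolynomial.X j + 1) (mul_one k)
  simp only [pleth, h, transl]

theorem hallForm_schur_stableIrr (la mu : YoungDiagram) : hallForm (schur mu) (stableIrr la) =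
    (-1) ^ (la.card + mu.card) * hall (pleth (fun k => psi k) (schur la.transpose) (p 1 + 1))
      (plethHat (schur mu.transpose) lieSeries) := by
  have h : antip (schur mu) = (-1 : ℚ) ^ mu.card • schur mu.transpose := by
    have h1 := congrArg antip (antip_schur_transpose mu)
    rw [antip_antip, map_smul] at h1
    rw [h1, smul_smul, neg_one_pow_mul_self, one_smul]
  rw [stableIrr, neg_one_pow_mul_eq_smul, map_smul, hallForm_apply, hall_hall, sigmaOne_eq,
    hall_sig_mul, h, map_smul, hall_smul_right, pleth_p_one_add_one, plethHat_lieSeries, pow_add,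
    smul_eq_mul, smul_eq_mul, mul_assoc]

end SymFun

theorem mainTheorem4 (la : YoungDiagram) :
    (∃! s : SymFun.Sym, SymFun.IsStableIrreducible la s) ∧
    (∃! x : SymFun.Sym, SymFun.IsStableInduced la x) ∧
    (∀ s : SymFun.Sym, SymFun.IsStableIrreducible la s →
      (∃! b : YoungDiagram →₀ ℚ, s = b.sum fun mu a => a • SymFun.schur mu) ∧
      (∀ b : YoungDiagram →₀ ℚ, (s = b.sum fun mu a => a • SymFun.schur mu) →
        ∀ mu : YoungDiagram,
          b mu = (-1) ^ (la.card + mu.card) *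
            SymFun.hall
              (SymFun.pleth (fun k => SymFun.psi k) (SymFun.schur la.transpose) (SymFun.p 1 + 1))
              (SymFun.plethHat (SymFun.schur mu.transpose) SymFun.lieSeries)) ∧
      s = (-1) ^ la.card *
        SymFun.hall (SymFun.schur la.transpose)
          (SymFun.inX SymFun.sigmaOne *
            SymFun.lambdaNegOne (SymFun.inX SymFun.lieSeries * SymFun.inY (SymFun.p 1)))) ∧
    (∀ x : SymFun.Sym, SymFun.IsStableInduced la x →
      x = (-1) ^ la.card *
        SymFun.hall (SymFun.schur la.transpose)
          (SymFun.lambdaNegOne (SymFun.inX SymFun.lieSeries * SymFun.inY (SymFun.p 1)))) := by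
  simp only [SymFun.isStableIrreducible_iff, SymFun.isStableInduced_iff]
  refine ⟨existsUnique_eq, existsUnique_eq, ?_, fun x hx => hx⟩
  intro s hs
  refine ⟨SymFun.existsUnique_schurSum s, fun b hb mu => ?_, hs⟩
  rw [← SymFun.hallForm_schur_stableIrr, ← hs, hb, ← SymFun.schurSum_apply,
    SymFun.hallForm_schurSum]
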